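/- Let $p$ and $\ell$ be primes, let $q=\ell^{n}$ be a prime power, and let $G=\mathrm{Aff}(q)$ be the group of transformations $x\mapsto ax+b$ ($a\in\mathbb{F}_q^{\times}$, $b\in\mathbb{F}_q$) of $\mathbb{F}_q$. Write $\zeta(R)$ for the centre of a ring $R$. Let $e_1,\dots,e_t$ be the central primitive idempotents of $\mathbb{Q}_p[G]$, so that $\mathbb{Q}_p[G]e_i$ is a central simple algebra over its centre $F_i$; let $n_i^2$ be its dimension over $F_i$. For a square matrix $H\in M_{m\times m}(\mathbb{Q}_p[G])$ ($m\ge 1$) put $H_i=He_i$, and let $f_i(X)=\sum_{j=0}^{n_i m}\alpha_{ij}X^j\in F_i[X]$ be the reduced characteristic polynomial of $H_i\in M_{m\times m}(\mathbb{Q}_p[G]e_i)$. The reduced norm and the generalised adjoint matrix of $H$ are $$\mathrm{nr}(H)=\sum_{i=1}^t(-1)^{n_i m}\alpha_{i0},\qquad H^{*}=\sum_{i=1}^{t}(-1)^{n_i m+1}\sum_{j=1}^{n_i m}\alpha_{ij}H_i^{j-1}\qquad(\text{where } H_i^0 \text{ is the identity of } M_{m\times m}(\mathbb{Q}_p[G]e_i)).$$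 Define $$\mathcal{H}_p(G)=\{x\in\zeta(\mathbb{Z}_p[G]) \mid xH^{*}\in M_{m\times m}(\mathbb{Z}_p[G])\ \text{for all } m\ge 1 \text{ and all } H\in M_{m\times m}(\mathbb{Z}_p[G])\},$$ and let $\mathcal{I}_p(G)$ be the $\zeta(\mathbb{Z}_p[G])$-submodule of $\zeta(\mathbb{Q}_p[G])$ generated by all $\mathrm{nr}(H)$ with $H\in M_{m\times m}(\mathbb{Z}_p[G])$, $m\ge 1$. Let $\mathfrak{M}_p(G)$ be any maximal $\mathbb{Z}_p$-order with $\mathbb{Z}_p[G]\subseteq\mathfrak{M}_p(G)\subseteq\mathbb{Q}_p[G]$, and let $\mathcal{F}_p(G)=\{x\in\zeta(\mathfrak{M}_p(G))\mid x\,\mathfrak{M}_p(G)\subseteq\mathbb{Z}_p[G]\}$ be the central conductor. Then: 1. If $p\neq\ell$, then $\mathcal{H}_p(G)=\zeta(\mathbb{Z}_p[G])$ and $\mathcal{I}_p(G)=\zeta(\mathbb{Z}_p[G])$. 2. If $p=\ell\neq 2$, then $\mathcal{H}_p(G)=\mathcal{F}_p(G)$ and $\mathcal{I}_p(G)=\zeta(\mathfrak{M}_p(G))$.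 3. If $p=\ell=2$, then $2\mathcal{H}_2(G)\subseteq\mathcal{F}_2(G)\subseteq\mathcal{H}_2(G)$ and $2\zeta(\mathfrak{M}_2(G))\subseteq\mathcal{I}_2(G)\subseteq\zeta(\mathfrak{M}_2(G))$. -/

import Mathlib

open Polynomial TensorProduct
open scoped Pointwise

noncomputable section

namespace DenominatorIdeal

/-! ### Reduced characteristic polynomials in central simple algebras -/

/-- `f` is the reduced characteristic polynomial of the element `b` of the central simple
`F`-algebra `B`: after splitting `B` over an algebraic closure of `F`, it becomes the
characteristic polynomial of the matrix corresponding to `b`. -/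
def IsReducedCharpoly (F : Type*) [Field F] {B : Type*} [Ring B] [Algebra F B]
    (b : B) (f : F[X]) : Prop :=
  ∃ (m : ℕ) (h : (AlgebraicClosure F ⊗[F] B) ≃ₐ[AlgebraicClosure F]
      Matrix (Fin m) (Fin m) (AlgebraicClosure F)),
    f.map (algebraMap F (AlgebraicClosure F)) = (h (1 ⊗ₜ[F] b)).charpoly

open Classical in
/-- The reduced characteristic polynomial of an element of a finite-dimensional central simple
algebra `B` over the field `F` (in that situation it exists, lies in `F[X]`, and does not depend
on the splitting). -/
def reducedCharpoly (F : Type*) [Field F] {B : Type*} [Ring B] [Algebra F B] (b : B) : F[X] :=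
  if h : ∃ f : F[X], IsReducedCharpoly F b f then h.choose else 0

/-! ### The simple components of a semisimple ring -/

/-- Central primitive idempotents: the nonzero central idempotents that dominate no central
idempotent other than `0` and themselves. -/
structure IsCentralPrimitiveIdempotent {A : Type*} [Ring A] (e : A) : Prop where
  idem : IsIdempotentElem e
  central : e ∈ Subring.center A
  ne_zero : e ≠ 0
  primitive : ∀ f : A, IsIdempotentElem f → f ∈ Subring.center A → f * e = f → f = 0 ∨ f = e

/-- The (finite) set of central primitive idempotents of `A`. -/
abbrev CPI (A : Type*) [Ring A] : Type _ := {e : A // IsCentralPrimitiveIdempotent e}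

/-- The simple component `Ae = eAe` attached to a central primitive idempotent `e`. -/
abbrev Component {A : Type*} [Ring A] (e : CPI A) : Type _ := e.2.idem.Corner

variable {A : Type*} [Ring A]

/-- The component `xe = exe` of an element `x` of `A` in `Ae`. -/
def proj (e : CPI A) (x : A) : Component e := ⟨e.1 * x * e.1, x, rfl⟩

theorem component_left (e : CPI A) (x : Component e) : e.1 * x.1 = x.1 :=
  congrArg Subtype.val (one_mul x)

theorem component_right (e : CPI A) (x : Component e) : x.1 * e.1 = x.1 :=
  congrArg Subtype.val (mul_one x)

/-- In a semisimple ring every two-sided ideal has a two-sided complement. -/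
theorem exists_twoSided_compl [IsSemisimpleRing A] (I : Ideal A) (hI : I.IsTwoSided) :
    ∃ J : Ideal A, J.IsTwoSided ∧ I ⊓ J = ⊥ ∧ I ⊔ J = ⊤ := by
  have hc : ComplementedLattice (fullyInvariantSubmodule A A) :=
    (OrderIso.setIsotypicComponents (R := A) (M := A)).complementedLattice
  obtain ⟨J, hJ⟩ := hc.exists_isCompl
    (⟨I, isFullyInvariant_iff_isTwoSided.mpr hI⟩ : fullyInvariantSubmodule A A)
  exact ⟨J.1, isFullyInvariant_iff_isTwoSided.mp J.2,
    congrArg Subtype.val hJ.inf_eq_bot, congrArg Subtype.val hJ.sup_eq_top⟩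

/-- The simple components of a semisimple ring are simple rings. -/
instance instIsSimpleRingComponent [IsSemisimpleRing A] (e : CPI A) :
    IsSimpleRing (Component e) := by
  have hcen : ∀ a : A, e.1 * a = a * e.1 := fun a =>
    (Subring.mem_center_iff.mp e.2.central a).symm
  rw [isSimpleRing_iff_isTwoSided_imp]
  refine ⟨⟨⟨0, 1, fun h => e.2.ne_zero (congrArg Subtype.val h).symm⟩⟩, fun I hI => ?_⟩
  let I' : Ideal A :=
    { carrier := {x | ∃ y ∈ I, y.1 = x}
      zero_mem' := ⟨0, I.zero_mem, rfl⟩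
      add_mem' := by
        rintro _ _ ⟨x, hx, rfl⟩ ⟨y, hy, rfl⟩
        exact ⟨x + y, I.add_mem hx hy, rfl⟩
      smul_mem' := by
        rintro c _ ⟨x, hx, rfl⟩
        refine ⟨proj e c * x, I.mul_mem_left _ hx, ?_⟩
        change e.1 * c * e.1 * x.1 = c * x.1
        rw [hcen c, mul_assoc, mul_assoc, component_left, component_left] }
  have hI' : I'.IsTwoSided := ⟨by
    rintro _ c ⟨x, hx, rfl⟩
    refine ⟨x * proj e c, hI.mul_mem_of_left _ hx, ?_⟩
    change x.1 * (e.1 * c * e.1) = x.1 * c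
    rw [mul_assoc e.1, ← hcen c, ← mul_assoc, ← mul_assoc, component_right, component_right]⟩
  obtain ⟨J, hJ, hinf, hsup⟩ := exists_twoSided_compl I' hI'
  have hz : ∀ x, x ∈ I' → x ∈ J → x = 0 := fun x h1 h2 => by
    have : x ∈ I' ⊓ J := ⟨h1, h2⟩
    rwa [hinf] at this
  obtain ⟨f, hf, g, hg, hfg⟩ := Submodule.mem_sup.mp (hsup ▸ Submodule.mem_top : (1 : A) ∈ I' ⊔ J)
  have hgf : g = 1 - f := by rw [← hfg]; abel
  have hidem : f * f = f := by
    have h0 : g * f = 0 := hz _ (I'.mul_mem_left _ hf) (hJ.mul_mem_of_left _ hg)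
    rw [hgf, sub_mul, one_mul, sub_eq_zero] at h0
    exact h0.symm
  have hfc : f ∈ Subring.center A := by
    rw [Subring.mem_center_iff]
    intro a
    have h1 : a * f - f * a ∈ I' := I'.sub_mem (I'.mul_mem_left _ hf) (hI'.mul_mem_of_left _ hf)
    have h2 : a * f - f * a ∈ J := by
      have h3 : a * f - f * a = g * a - a * g := by rw [hgf]; noncomm_ring
      rw [h3]
      exact J.sub_mem (hJ.mul_mem_of_left _ hg) (J.mul_mem_left _ hg)
    exact sub_eq_zero.mp (hz _ h1 h2)
  obtain ⟨y, hy, hyf⟩ := hf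
  have hfe : f * e.1 = f := by rw [← hyf]; exact component_right e y
  rcases e.2.primitive f hidem hfc hfe with h0 | h1
  · left
    rw [eq_bot_iff]
    intro x hx
    have hxJ : x.1 ∈ J := by
      have : x.1 * g ∈ J := J.mul_mem_left _ hg
      rwa [hgf, h0, sub_zero, mul_one] at this
    exact Subtype.ext (hz _ ⟨x, hx, rfl⟩ hxJ)
  · right
    rw [Ideal.eq_top_iff_one]
    have : y = 1 := Subtype.ext (hyf.trans h1)
    exact this ▸ hy

/-- The centre of the simple component `Ae`, a field. -/
abbrev CentreField (e : CPI A) : Type _ := Subring.center (Component e)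

instance instFieldCentreField [IsSemisimpleRing A] (e : CPI A) : Field (CentreField e) :=
  (IsSimpleRing.isField_center (Component e)).toField

variable [IsSemisimpleRing A]

/-! ### Reduced norms and generalised adjoints of matrices over a semisimple ring -/

/-- The component `H_e` in `M_n(Ae)` of a matrix `H` in `M_n(A)`. -/
def matrixProj {n : ℕ} (H : Matrix (Fin n) (Fin n) A) (e : CPI A) :
    Matrix (Fin n) (Fin n) (Component e) := H.map (proj e)

/-- The reduced characteristic polynomial of the component `H_e`; its degree is `n` times the
degree of the central simple algebra `Ae`. -/
def componentCharpoly {n : ℕ} (H : Matrix (Fin n) (Fin n) A) (e : CPI A) : (CentreField e)[X] :=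
  reducedCharpoly (CentreField e) (matrixProj H e)

/-- The reduced norm of the component `H_e`: up to the sign `(-1) ^ deg`, the constant
coefficient of the reduced characteristic polynomial. -/
def componentNorm {n : ℕ} (H : Matrix (Fin n) (Fin n) A) (e : CPI A) : CentreField e :=
  (-1) ^ (componentCharpoly H e).natDegree * (componentCharpoly H e).coeff 0

/-- The generalised adjoint of the component `H_e`. -/
def componentAdjoint {n : ℕ} (H : Matrix (Fin n) (Fin n) A) (e : CPI A) :
    Matrix (Fin n) (Fin n) (Component e) :=
  (-1) ^ ((componentCharpoly H e).natDegree + 1) *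
    ∑ j ∈ Finset.Icc 1 (componentCharpoly H e).natDegree,
      (componentCharpoly H e).coeff j • matrixProj H e ^ (j - 1)

/-- The reduced norm `nr(H)`, as an element of `A` (it lies in the centre). -/
def reducedNorm {n : ℕ} (H : Matrix (Fin n) (Fin n) A) : A :=
  ∑ᶠ e : CPI A, (componentNorm H e : Component e).1

/-- The generalised adjoint matrix `H*` of `H`. -/
def genAdjoint {n : ℕ} (H : Matrix (Fin n) (Fin n) A) : Matrix (Fin n) (Fin n) A :=
  ∑ᶠ e : CPI A, (componentAdjoint H e).map (fun x : Component e => x.1)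

/-! ### Orders, central conductors and denominator ideals -/

section orders

variable {R : Type*} [CommRing R] [Algebra R A]

/-- The centre `ζ(Λ)` of a subalgebra `Λ` of `A`, as a subalgebra of `A`. -/
def centre (Λ : Subalgebra R A) : Subalgebra R A := (Subalgebra.center R Λ).map Λ.val

/-- `Λ` is a (full) `R`-order in the `K`-algebra `A`. -/
def IsOrder (K : Type*) [Field K] [Algebra R K] [Algebra K A] [IsScalarTower R K A]
    (Λ : Subalgebra R A) : Prop :=
  Submodule.IsLattice (A := K) (Subalgebra.toSubmodule Λ)

/-- `Λ` is a maximal `R`-order in the `K`-algebra `A`. -/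
def IsMaximalOrder (K : Type*) [Field K] [Algebra R K] [Algebra K A] [IsScalarTower R K A]
    (Λ : Subalgebra R A) : Prop :=
  Maximal (fun Γ : Subalgebra R A => IsOrder K Γ) Λ

/-- The central conductor `{x ∈ ζ(Γ) | xΓ ⊆ Λ}` of `Γ` into `Λ`. -/
def centralConductor (Γ Λ : Subalgebra R A) : Submodule R A where
  carrier := {x | x ∈ centre Γ ∧ ∀ y ∈ Γ, x * y ∈ Λ}
  zero_mem' := ⟨zero_mem _, fun y _ => by rw [zero_mul]; exact zero_mem _⟩
  add_mem' := fun ha hb =>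
    ⟨add_mem ha.1 hb.1, fun y hy => by rw [add_mul]; exact add_mem (ha.2 y hy) (hb.2 y hy)⟩
  smul_mem' := fun c _ ha =>
    ⟨Subalgebra.smul_mem _ ha.1 c, fun y hy => by
      rw [smul_mul_assoc]; exact Subalgebra.smul_mem _ (ha.2 y hy) c⟩

/-- The matrix `H` has all its entries in `Λ`. -/
def HasEntriesIn {n : ℕ} (Λ : Subalgebra R A) (H : Matrix (Fin n) (Fin n) A) : Prop :=
  ∀ i j, H i j ∈ Λ

/-- The denominator ideal of `Λ`: all `x ∈ ζ(Λ)` such that `x H*` has entries in `Λ` for every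
square matrix `H` (of any size) with entries in `Λ`. -/
def denominatorIdeal (Λ : Subalgebra R A) : Submodule R A where
  carrier := {x | x ∈ centre Λ ∧ ∀ n : ℕ, 0 < n → ∀ H : Matrix (Fin n) (Fin n) A,
    HasEntriesIn Λ H → HasEntriesIn Λ (x • genAdjoint H)}
  zero_mem' := ⟨zero_mem _, fun n _ H _ i j => by
    rw [zero_smul]; exact zero_mem _⟩
  add_mem' := fun ha hb => ⟨add_mem ha.1 hb.1, fun n hn H hH i j => by
    rw [add_smul]; exact add_mem (ha.2 n hn H hH i j) (hb.2 n hn H hH i j)⟩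
  smul_mem' := fun c _ ha => ⟨Subalgebra.smul_mem _ ha.1 c, fun n hn H hH i j => by
    rw [smul_assoc]; exact Subalgebra.smul_mem _ (ha.2 n hn H hH i j) c⟩

/-- The `ζ(Λ)`-submodule of `A` generated by the reduced norms of all square matrices (of any
size) with entries in `Λ`, regarded as an `R`-module. -/
def normIdeal (Λ : Subalgebra R A) : Submodule R A :=
  (Submodule.span (centre Λ) {x : A | ∃ n : ℕ, 0 < n ∧ ∃ H : Matrix (Fin n) (Fin n) A,
    HasEntriesIn Λ H ∧ reducedNorm H = x}).restrictScalars R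

end orders

/-! ### Group rings and affine groups -/

/-- The `p`-adic group ring `ℤ_p[G]` inside `ℚ_p[G]`. -/
def padicGroupRing (p : ℕ) [Fact p.Prime] (G : Type*) [Group G] :
    Subalgebra ℤ_[p] (MonoidAlgebra ℚ_[p] G) :=
  (MonoidAlgebra.mapAlgHom G (Algebra.ofId ℤ_[p] ℚ_[p])).range

/-- The group of affine transformations `x ↦ ax + b` (with `a ≠ 0`) of the line over `F`. -/
abbrev Aff (F : Type*) [Field F] : Type _ := F ≃ᵃ[F] F

instance instFiniteAff (F : Type*) [Field F] [Finite F] : Finite (Aff F) :=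
  Finite.of_injective (fun g : Aff F => (g : F → F)) DFunLike.coe_injective

end DenominatorIdeal

end

/-!
The group algebra of `G = Aff(q)` over `ℚ_p` is the product of the commutative algebra `ℚ_p[Fˣ]`
and a full matrix ring of size `q - 1`: the two projections are induced by the multiplier `G → Fˣ`
and by the permutation representation on functions on the line, modulo constants
(`affEquiv`). Everything rests on one formula for the coefficients of an element `x` of the
group algebra with images `y` and `N`, namely `q x_1 = tr N + y_1` (`card_mul_coeff_one`), and
its translates by group elements. It shows that the decomposition is injective, hence bijective
by a count of dimensions, and that `q` times any order that contains the group ring and whose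
elements have integral images `y` and integral traces `tr N` lies in the group ring
(`card_smul_mem`).

Reduced norms and generalised adjoints become the determinant and the classical expression for
the adjoint in terms of the characteristic polynomial over the two factors (`apply_reducedNorm`,
`apply_genAdjoint`). For this one identifies the simple components: one of them is the matrix
ring and the others are fields, cut out of the commutative factor. On a split central simple
algebra the reduced characteristic polynomial is the usual one (`reducedCharpoly_of_split`),
because isomorphisms of matrix algebras are inner. Hence the generalised adjoints of integral
matrices lie in the split order `ℤ_p[Fˣ] × M(ℤ_p)` and their reduced norms in its centre
`Z = ℤ_p[Fˣ] × ℤ_p` (`splitOrder`, `splitCentre`).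

If `p ∤ q`, the coefficient formula shows that the group ring is the split order, and both
claims follow. If `p ∣ q`, then `q - 1` is a unit, so `ℤ_p[Fˣ]` is integrally closed in
`ℚ_p[Fˣ]`, and `Z` is the centre of every maximal order containing the group ring
(`centre_eq_splitCentre`). The coefficient formula then identifies the central conductor with `q Z`
(`exists_eq_card_smul`, `card_smul_mem_centralConductor`), so that it is contained in the
denominator ideal. For the remaining inclusions it suffices that `2 Z` is contained in the norm
ideal (`two_smul_mem_normIdeal`), since the denominator ideal multiplies norms into the group
ring; explicit norms `nr(g)`, `nr(-g)` and, for even `q`, `nr(g (1 + t))` with a translation `t`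
show this.
-/

noncomputable section

namespace DenominatorIdeal

/-! ### Reduced characteristic polynomials of split algebras -/

/-- An isomorphism between matrix algebras over a field preserves characteristic polynomials:
it is conjugation by a linear isomorphism of the underlying spaces. -/
theorem charpoly_algEquiv {K m n : Type*} [Field K] [Fintype m] [DecidableEq m] [Fintype n]
    [DecidableEq n] (f : Matrix m m K ≃ₐ[K] Matrix n n K) (M : Matrix m m K) :
    (f M).charpoly = M.charpoly := by
  obtain ⟨T, hT⟩ := AlgEquiv.eq_linearEquivConjAlgEquiv
    ((Matrix.toLinAlgEquiv'.symm.trans f).trans Matrix.toLinAlgEquiv')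
  have h : Matrix.toLin' (f M) = T.conj (Matrix.toLin' M) := by
    have := DFunLike.congr_fun hT (Matrix.toLin' M)
    have h2 : LinearMap.toMatrixAlgEquiv' (Matrix.toLin' M) = M :=
      LinearMap.toMatrix'_toLin' M
    simp only [AlgEquiv.trans_apply, Matrix.toLinAlgEquiv'_symm, h2] at this
    exact this
  rw [← Matrix.charpoly_toLin' (f M), h, LinearEquiv.charpoly_conj, Matrix.charpoly_toLin']

/-- A split algebra stays split over the algebraic closure, with the expected matrices. -/
theorem isReducedCharpoly_of_split {F B ι : Type*} [Field F] [Ring B] [Algebra F B] [Fintype ι]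
    [DecidableEq ι] (φ : B ≃ₐ[F] Matrix ι ι F) (b : B) : IsReducedCharpoly F b (φ b).charpoly := by
  let K := AlgebraicClosure F
  let e : (K ⊗[F] Matrix ι ι F) ≃ₐ[K] Matrix ι ι K :=
    AlgEquiv.ofRingEquiv (f := (matrixEquivTensor ι F K).symm.toRingEquiv) (fun a => by
      change (matrixEquivTensor ι F K).symm (a ⊗ₜ 1) = _
      rw [matrixEquivTensor_apply_symm, Matrix.map_one _ (map_zero _) (map_one _),
        Algebra.algebraMap_eq_smul_one])
  let r := Fintype.equivFin ι
  refine ⟨Fintype.card ι, ((Algebra.TensorProduct.congr AlgEquiv.refl φ).trans e).trans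
    (Matrix.reindexAlgEquiv K K r), ?_⟩
  have h1 : e (1 ⊗ₜ φ b) = (φ b).map (algebraMap F K) := by
    change (matrixEquivTensor ι F K).symm (1 ⊗ₜ φ b) = _
    rw [matrixEquivTensor_apply_symm, one_smul]
  have h2 : (((Algebra.TensorProduct.congr AlgEquiv.refl φ).trans e).trans
      (Matrix.reindexAlgEquiv K K r)) (1 ⊗ₜ b) =
      Matrix.reindex r r ((φ b).map (algebraMap F K)) := by
    rw [← h1]; rfl
  rw [h2, Matrix.charpoly_reindex, Matrix.charpoly_map]

theorem IsReducedCharpoly.unique {F B : Type*} [Field F] [Ring B] [Algebra F B] {b : B}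
    {f g : F[X]} (hf : IsReducedCharpoly F b f) (hg : IsReducedCharpoly F b g) : f = g := by
  obtain ⟨m, h, hf⟩ := hf
  obtain ⟨n, k, hg⟩ := hg
  apply Polynomial.map_injective _ (algebraMap F (AlgebraicClosure F)).injective
  rw [hf, hg, ← charpoly_algEquiv (h.symm.trans k)]
  simp

theorem reducedCharpoly_of_split {F B ι : Type*} [Field F] [Ring B] [Algebra F B] [Fintype ι]
    [DecidableEq ι] (φ : B ≃ₐ[F] Matrix ι ι F) (b : B) : reducedCharpoly F b = (φ b).charpoly := by
  have h : ∃ f : F[X], IsReducedCharpoly F b f := ⟨_, isReducedCharpoly_of_split φ b⟩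
  rw [reducedCharpoly, dif_pos h]
  exact h.choose_spec.unique (isReducedCharpoly_of_split φ b)

/-- The form in which split algebras arise here: the matrices have entries in a field `K` that is
merely isomorphic to `F`. -/
theorem map_reducedCharpoly_of_ringEquiv {F B K ι : Type*} [Field F] [Ring B] [Algebra F B]
    [Field K] [Fintype ι] [DecidableEq ι] (σ : F ≃+* K) (T : B ≃+* Matrix ι ι K)
    (hT : ∀ z, T (algebraMap F B z) = Matrix.scalar ι (σ z)) (b : B) :
    (reducedCharpoly F b).map (σ : F →+* K) = (T b).charpoly := by
  let φ : B ≃ₐ[F] Matrix ι ι F := AlgEquiv.ofRingEquiv (f := T.trans σ.symm.mapMatrix) (fun z => by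
    rw [RingEquiv.trans_apply, hT]
    ext i j
    by_cases hij : i = j <;> simp [hij, Matrix.algebraMap_matrix_apply])
  rw [reducedCharpoly_of_split φ, ← Matrix.charpoly_map]
  congr 1
  ext i j
  change σ (σ.symm (T b i j)) = _
  simp

/-! ### The generalised adjoint of a matrix over a commutative ring -/

/-- The generalised adjoint of a square matrix over a commutative ring, given by the same formula
in terms of the characteristic polynomial as for semisimple algebras. (It is the classical
adjugate, but only the two properties below are used.) -/
def charpolyAdjoint {R ι : Type*} [CommRing R] [Fintype ι] [DecidableEq ι] (M : Matrix ι ι R) :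
    Matrix ι ι R :=
  (-1) ^ (Fintype.card ι + 1) *
    ∑ j ∈ Finset.Icc 1 (Fintype.card ι), M.charpoly.coeff j • M ^ (j - 1)

theorem charpolyAdjoint_map {R S ι : Type*} [CommRing R] [CommRing S] [Fintype ι] [DecidableEq ι]
    (f : R →+* S) (M : Matrix ι ι R) :
    (charpolyAdjoint M).map f = charpolyAdjoint (M.map f) := by
  simp only [charpolyAdjoint, ← RingHom.mapMatrix_apply]
  simp only [map_mul, map_pow, map_neg, map_one, map_sum]
  congr 1
  refine Finset.sum_congr rfl fun j _ => ?_
  rw [← map_pow, RingHom.mapMatrix_apply, RingHom.mapMatrix_apply, Matrix.charpoly_map,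
    Polynomial.coeff_map]
  ext a b
  simp

theorem charpolyAdjoint_reindex {R ι κ : Type*} [CommRing R] [Fintype ι] [DecidableEq ι]
    [Fintype κ] [DecidableEq κ] (e : ι ≃ κ) (M : Matrix ι ι R) :
    charpolyAdjoint (Matrix.reindex e e M) = Matrix.reindex e e (charpolyAdjoint M) := by
  simp only [charpolyAdjoint, Matrix.charpoly_reindex, Fintype.card_congr e]
  simp only [← Matrix.coe_reindexAlgEquiv R R, map_mul, map_pow, map_neg, map_one, map_sum,
    map_smul]

theorem charpolyAdjoint_mul {R ι : Type*} [CommRing R] [Fintype ι] [DecidableEq ι]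
    (M : Matrix ι ι R) : charpolyAdjoint M * M = Matrix.scalar ι M.det := by
  nontriviality R
  have h := M.aeval_self_charpoly
  rw [Polynomial.aeval_eq_sum_range, M.charpoly_natDegree_eq_dim, Finset.sum_range_succ'] at h
  have h2 : (∑ j ∈ Finset.Icc 1 (Fintype.card ι), M.charpoly.coeff j • M ^ (j - 1)) * M =
      ∑ j ∈ Finset.range (Fintype.card ι), M.charpoly.coeff (j + 1) • M ^ (j + 1) := by
    rw [Finset.sum_mul, Finset.range_eq_Ico,
      Finset.sum_Ico_add' (fun j => M.charpoly.coeff j • M ^ j) 0 _ 1]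
    refine Finset.sum_congr rfl fun j hj => ?_
    obtain ⟨k, rfl⟩ : ∃ k, j = k + 1 := ⟨j - 1, by simp at hj; omega⟩
    simp [pow_succ]
  rw [Matrix.det_eq_sign_charpoly_coeff, charpolyAdjoint, mul_assoc, h2,
    eq_neg_of_add_eq_zero_left h, pow_succ]
  change _ = algebraMap R (Matrix ι ι R) _
  simp only [pow_zero, mul_neg, mul_one, neg_mul, neg_neg, map_mul, map_pow, map_neg, map_one,
    ← Algebra.algebraMap_eq_smul_one]

/-! ### Split components -/

section component

variable {A : Type*} [Ring A]

/-- If a component is a matrix ring over the field `K`, then its centre is isomorphic to `K`, acting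
through scalar matrices. -/
theorem exists_centreField_equiv [IsSemisimpleRing A] {K ι : Type*} [Field K] [Fintype ι]
    [DecidableEq ι] [Nonempty ι] (e : CPI A) (τ : Component e ≃+* Matrix ι ι K) :
    ∃ σ : CentreField e ≃+* K, ∀ z : CentreField e, τ z.1 = Matrix.scalar ι (σ z) := by
  have hmem : ∀ k, ((τ.symm : Matrix ι ι K →+* Component e).comp (Matrix.scalar ι)) k ∈
      Subring.center (Component e) := fun k => by
    rw [Subring.mem_center_iff]
    intro x
    apply τ.injective
    simp only [RingHom.comp_apply, RingEquiv.coe_toRingHom, map_mul, RingEquiv.apply_symm_apply]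
    exact ((Matrix.scalar_commute k (fun r' => mul_comm k r') (τ x)).eq).symm
  let s : K →+* CentreField e := RingHom.codRestrict _ (Subring.center (Component e)) hmem
  have hs : Function.Bijective s := by
    refine ⟨s.injective, fun z => ?_⟩
    have hz : τ z.1 ∈ Set.range (Matrix.scalar ι) := by
      refine Matrix.mem_range_scalar_of_commute_single fun i j _ => ?_
      have := (Subring.mem_center_iff.mp z.2) (τ.symm (Matrix.single i j 1))
      simpa [Commute, SemiconjBy] using congrArg τ this
    obtain ⟨k, hk⟩ := hz
    exact ⟨k, Subtype.ext (τ.injective (by simp [s, hk]))⟩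
  refine ⟨(RingEquiv.ofBijective s hs).symm, fun z => ?_⟩
  obtain ⟨k, rfl⟩ := hs.2 z
  have h1 : (RingEquiv.ofBijective s hs).symm (s k) = k :=
    (RingEquiv.ofBijective s hs).symm_apply_apply k
  rw [h1]
  simp [s]

variable {K ι : Type*} [Field K] [Fintype ι] [DecidableEq ι] {n : ℕ}

/-- Matrices over a component that is itself a matrix ring, as matrices of larger size. -/
def splitMatrix {e : CPI A} (τ : Component e ≃+* Matrix ι ι K) :
    Matrix (Fin n) (Fin n) (Component e) ≃+* Matrix (Fin n × ι) (Fin n × ι) K :=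
  τ.mapMatrix.trans (Matrix.compRingEquiv (Fin n) ι K)

theorem splitMatrix_apply {e : CPI A} (τ : Component e ≃+* Matrix ι ι K)
    (M : Matrix (Fin n) (Fin n) (Component e)) (i j : Fin n) (a b : ι) :
    splitMatrix τ M (i, a) (j, b) = τ (M i j) a b := rfl

variable [IsSemisimpleRing A] [Nonempty ι]

/-- The centre field of a split component is identified with `K` compatibly with all matrix sizes,
and the reduced characteristic polynomials become ordinary ones under this identification. -/
theorem exists_map_componentCharpoly {e : CPI A} (τ : Component e ≃+* Matrix ι ι K) :
    ∃ σ : CentreField e ≃+* K, (∀ z : CentreField e, τ z.1 = Matrix.scalar ι (σ z)) ∧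
      (∀ z : CentreField e, splitMatrix τ (algebraMap _ (Matrix (Fin n) (Fin n) (Component e)) z) =
        Matrix.scalar (Fin n × ι) (σ z)) ∧
      ∀ H : Matrix (Fin n) (Fin n) A, (componentCharpoly H e).map (σ : CentreField e →+* K) =
        (splitMatrix τ (matrixProj H e)).charpoly := by
  obtain ⟨σ, hσ⟩ := exists_centreField_equiv e τ
  have h : ∀ z : CentreField e,
      splitMatrix τ (algebraMap _ (Matrix (Fin n) (Fin n) (Component e)) z) =
        Matrix.scalar (Fin n × ι) (σ z) := by
    intro z
    ext ⟨i, a⟩ ⟨j, b⟩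
    rw [splitMatrix_apply, Matrix.algebraMap_matrix_apply]
    by_cases hij : i = j
    · subst hij
      rw [if_pos rfl]
      change τ z.1 a b = _
      rw [hσ]
      by_cases hab : a = b <;> simp [hab]
    · simp [hij]
  exact ⟨σ, hσ, h, fun H => map_reducedCharpoly_of_ringEquiv σ (splitMatrix τ) h _⟩

theorem natDegree_componentCharpoly {e : CPI A} (τ : Component e ≃+* Matrix ι ι K)
    (H : Matrix (Fin n) (Fin n) A) :
    (componentCharpoly H e).natDegree = Fintype.card (Fin n × ι) := by
  obtain ⟨σ, -, -, h⟩ := exists_map_componentCharpoly (n := n) τ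
  rw [← Matrix.charpoly_natDegree_eq_dim (splitMatrix τ (matrixProj H e)), ← h,
    Polynomial.natDegree_map_eq_of_injective σ.injective]

theorem splitMatrix_componentNorm {e : CPI A} (τ : Component e ≃+* Matrix ι ι K)
    (H : Matrix (Fin n) (Fin n) A) :
    τ (componentNorm H e).1 = Matrix.scalar ι (splitMatrix τ (matrixProj H e)).det := by
  obtain ⟨σ, hσ, -, h⟩ := exists_map_componentCharpoly (n := n) τ
  rw [hσ, Matrix.det_eq_sign_charpoly_coeff, ← h, componentNorm, natDegree_componentCharpoly τ,
    Polynomial.coeff_map, map_mul, map_pow, map_neg, map_one]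
  rfl

theorem splitMatrix_componentAdjoint {e : CPI A} (τ : Component e ≃+* Matrix ι ι K)
    (H : Matrix (Fin n) (Fin n) A) :
    splitMatrix τ (componentAdjoint H e) = charpolyAdjoint (splitMatrix τ (matrixProj H e)) := by
  obtain ⟨σ, -, hs, h⟩ := exists_map_componentCharpoly (n := n) τ
  rw [componentAdjoint, charpolyAdjoint, natDegree_componentCharpoly τ, map_mul, map_pow, map_neg,
    map_one, map_sum]
  congr 1
  refine Finset.sum_congr rfl fun j _ => ?_
  refine (congrArg (splitMatrix τ) (Algebra.smul_def (A := Matrix (Fin n) (Fin n) (Component e))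
    ((componentCharpoly H e).coeff j) _)).trans ?_
  rw [map_mul, hs, map_pow, ← h, Polynomial.coeff_map, Algebra.smul_def]
  rfl

end component

/-! ### Central primitive idempotents -/

section idempotents

variable {A : Type*} [Ring A]

theorem CPI.central (e : CPI A) (x : A) : x * e.1 = e.1 * x :=
  Subring.mem_center_iff.mp e.2.central x

/-- A central idempotent either annihilates a central primitive idempotent or dominates it. -/
theorem CPI.mul_eq_zero_or_eq (e : CPI A) {f : A} (hf : IsIdempotentElem f)
    (hfc : f ∈ Subring.center A) : f * e.1 = 0 ∨ f * e.1 = e.1 := by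
  refine e.2.primitive (f * e.1) ?_ (mul_mem hfc e.2.central) ?_
  · change f * e.1 * (f * e.1) = f * e.1
    rw [mul_assoc, ← mul_assoc e.1, ← e.central f, mul_assoc f, e.2.idem.eq, ← mul_assoc, hf.eq]
  · rw [mul_assoc, e.2.idem.eq]

theorem CPI.orthogonal {e f : CPI A} (h : e ≠ f) : e.1 * f.1 = 0 := by
  rcases f.mul_eq_zero_or_eq e.2.idem e.2.central with h0 | h1
  · exact h0
  rcases e.mul_eq_zero_or_eq f.2.idem f.2.central with h2 | h2
  · rw [f.central, h2]
  · exact absurd (Subtype.ext (h2.symm.trans ((f.central e.1).symm.trans h1))) h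

theorem span_lt_span_of_idempotent {u g : A} (hg : IsIdempotentElem g) (hgu : g * u = g)
    (hug : u * g = g) (hne : g ≠ u) : Ideal.span {g} < Ideal.span {u} := by
  refine lt_of_le_of_ne ?_ fun h => ?_
  · rw [Ideal.span_singleton_le_iff_mem, Ideal.mem_span_singleton']
    exact ⟨g, hgu⟩
  · have hu : u ∈ Ideal.span {g} := h ▸ Ideal.mem_span_singleton_self u
    obtain ⟨r, rfl⟩ := Ideal.mem_span_singleton'.mp hu
    rw [mul_assoc, hg.eq] at hug
    exact hne hug.symm

/-- Every central idempotent `u` is a sum of central primitive idempotents: unless `u` is itself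
zero or primitive, it splits as `f + (u - f)`, and both summands generate smaller ideals. -/
theorem exists_multiset_sum_cpi [IsArtinianRing A] (I : Ideal A) : ∀ u : A, Ideal.span {u} = I →
    IsIdempotentElem u → u ∈ Subring.center A →
    ∃ m : Multiset (CPI A), (m.map Subtype.val).sum = u := by
  induction I using WellFoundedLT.induction with
  | ind I ih =>
    rintro u rfl hu huc
    by_cases h0 : u = 0
    · exact ⟨0, by simp [h0]⟩
    by_cases hp : ∀ f : A, IsIdempotentElem f → f ∈ Subring.center A → f * u = f → f = 0 ∨ f = u
    · exact ⟨{⟨u, hu, huc, h0, hp⟩}, by simp⟩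
    push Not at hp
    obtain ⟨f, hf, hfc, hfu, hf0, hfne⟩ := hp
    have huf : u * f = f := by rw [Subring.mem_center_iff.mp hfc u, hfu]
    have hg : IsIdempotentElem (u - f) := by
      change (u - f) * (u - f) = u - f
      rw [sub_mul, mul_sub, mul_sub, hu.eq, huf, hfu, hf.eq, sub_self, sub_zero]
    obtain ⟨m₁, h₁⟩ := ih _ (span_lt_span_of_idempotent hf hfu huf hfne) f rfl hf hfc
    obtain ⟨m₂, h₂⟩ := ih _ (span_lt_span_of_idempotent hg (by rw [sub_mul, hu.eq, hfu])
      (by rw [mul_sub, hu.eq, huf]) (by simpa using hf0)) (u - f) rfl hg (sub_mem huc hfc)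
    exact ⟨m₁ + m₂, by simp [h₁, h₂]⟩

theorem exists_multiset_sum_cpi_eq_one [IsArtinianRing A] :
    ∃ m : Multiset (CPI A), (m.map Subtype.val).sum = 1 :=
  exists_multiset_sum_cpi _ 1 rfl IsIdempotentElem.one (one_mem _)

instance instFiniteCPI [IsArtinianRing A] : Finite (CPI A) := by
  classical
  obtain ⟨m, hm⟩ := exists_multiset_sum_cpi_eq_one (A := A)
  refine Set.finite_univ_iff.mp ((m.toFinset.finite_toSet).subset fun e _ => ?_)
  by_contra he
  apply e.2.ne_zero
  rw [← mul_one e.1, ← hm, ← Multiset.sum_map_mul_left]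
  refine Multiset.sum_eq_zero fun x hx => ?_
  obtain ⟨f, hf, rfl⟩ := Multiset.mem_map.mp hx
  exact CPI.orthogonal fun h => he (by simpa [h] using hf)

theorem CPI.mul_finsum [IsArtinianRing A] (e : CPI A) (x : CPI A → A)
    (hx : ∀ f, f.1 * x f = x f) : e.1 * ∑ᶠ f, x f = x e := by
  have := Fintype.ofFinite (CPI A)
  rw [finsum_eq_sum_of_fintype, Finset.mul_sum, Finset.sum_eq_single e, hx]
  · intro f _ hf
    rw [← hx f, ← mul_assoc, CPI.orthogonal hf.symm, zero_mul]
  · simp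

/-- Elements of an Artinian ring can be compared on the components. -/
theorem CPI.ext_of_mul [IsArtinianRing A] {x y : A} (h : ∀ e : CPI A, e.1 * x = e.1 * y) :
    x = y := by
  obtain ⟨m, hm⟩ := exists_multiset_sum_cpi_eq_one (A := A)
  rw [← one_mul x, ← one_mul y, ← hm, ← Multiset.sum_map_mul_right, ← Multiset.sum_map_mul_right]
  exact congrArg _ (Multiset.map_congr rfl fun e _ => h e)

variable [IsSemisimpleRing A] {n : ℕ}

theorem CPI.mul_reducedNorm (e : CPI A) (H : Matrix (Fin n) (Fin n) A) :
    e.1 * reducedNorm H = (componentNorm H e).1.1 :=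
  e.mul_finsum (fun e => (componentNorm H e).1.1) fun f => component_left f _

theorem CPI.mul_genAdjoint (e : CPI A) (H : Matrix (Fin n) (Fin n) A) (i j : Fin n) :
    e.1 * genAdjoint H i j = (componentAdjoint H e i j).1 := by
  have := Fintype.ofFinite (CPI A)
  rw [← e.mul_finsum (fun e => (componentAdjoint H e i j).1) fun f => component_left f _,
    genAdjoint, finsum_eq_sum_of_fintype, finsum_eq_sum_of_fintype, Matrix.sum_apply]
  rfl

end idempotents

/-! ### Products of a commutative ring and a matrix ring -/

section product

variable {A R K ι : Type*} [Ring A] [CommRing R] [Field K] [Fintype ι] [DecidableEq ι]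
  (Ψ : A ≃+* R × Matrix ι ι K)

/-- A component on which the commutative factor vanishes is the whole matrix factor. -/
def matrixComponentEquiv (e : CPI A) (he : Ψ e.1 = (0, 1)) : Component e ≃+* Matrix ι ι K where
  toFun x := (Ψ x.1).2
  invFun M := ⟨Ψ.symm (0, M), Ψ.symm (0, M), Ψ.injective (by simp [he])⟩
  left_inv x := Subtype.ext (Ψ.injective (by
    have h : Ψ (e.1 * x.1) = Ψ x.1 := by rw [component_left]
    rw [map_mul, he] at h
    simp only [RingEquiv.apply_symm_apply]
    exact Prod.ext (by rw [← h]; simp) rfl))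
  right_inv M := by simp
  map_mul' x y := by
    change (Ψ (x.1 * y.1)).2 = _
    rw [map_mul]; rfl
  map_add' x y := by
    change (Ψ (x.1 + y.1)).2 = _
    rw [map_add]; rfl

theorem apply_eq_zero_one [Nonempty ι] (e : CPI A) (he : (Ψ e.1).1 = 0) : Ψ e.1 = (0, 1) := by
  have hz : (Ψ e.1).2 ∈ Set.range (Matrix.scalar ι) := by
    refine Matrix.mem_range_scalar_of_commute_single fun i j _ => ?_
    have := congrArg (fun x => (Ψ x).2) (e.central (Ψ.symm (0, Matrix.single i j 1)))
    simpa [Commute, SemiconjBy] using this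
  obtain ⟨k, hk⟩ := hz
  have hi : k * k = k := by
    have := congrArg (fun x => (Ψ x).2) e.2.idem.eq
    simp only [map_mul, Prod.snd_mul, ← hk] at this
    rw [← map_mul] at this
    exact Matrix.scalar_inj.mp this
  have h0 : k ≠ 0 := by
    rintro rfl
    refine e.2.ne_zero (Ψ.injective (Prod.ext ?_ ?_))
    · simpa using he
    · rw [← hk]; simp
  have h1 : k = 1 := by simpa [h0] using hi
  exact Prod.ext he (by rw [← hk, h1]; simp)

theorem apply_snd_eq_zero_or [Nonempty ι] (e : CPI A) : (Ψ e.1).2 = 0 ∨ Ψ e.1 = (0, 1) := by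
  rcases e.mul_eq_zero_or_eq (f := Ψ.symm (1, 0)) (by
    change _ * _ = _
    rw [← map_mul]; simp) (by
    rw [Subring.mem_center_iff]
    intro x
    apply Ψ.injective
    ext <;> simp) with h | h
  · right
    apply apply_eq_zero_one
    simpa using congrArg (fun x => (Ψ x).1) h
  · left
    simpa using (congrArg (fun x => (Ψ x).2) h).symm

theorem component_comm {e : CPI A} (he : (Ψ e.1).2 = 0) (x y : Component e) : x * y = y * x := by
  have h : ∀ z : Component e, (Ψ z.1).2 = 0 := fun z => by
    rw [← component_left e z, map_mul, Prod.snd_mul, he, zero_mul]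
  refine Subtype.ext (Ψ.injective ?_)
  change Ψ (x.1 * y.1) = Ψ (y.1 * x.1)
  ext1
  · simp [mul_comm]
  · simp [h]

/-- A component on which the matrix factor vanishes is commutative, hence a matrix ring of size one
over its centre. -/
def commComponentEquiv {e : CPI A} (he : (Ψ e.1).2 = 0) :
    Component e ≃+* Matrix Unit Unit (CentreField e) where
  toFun x := Matrix.of fun _ _ => ⟨x, Subring.mem_center_iff.mpr fun y => component_comm Ψ he y x⟩
  invFun M := (M () ()).1
  left_inv _ := rfl
  right_inv M := by ext; rfl
  map_mul' x y := by
    ext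
    rw [Matrix.mul_apply]
    simp
  map_add' x y := rfl

/-- The projection of the commutative factor onto a commutative component. -/
def commComponentHom {e : CPI A} (he : (Ψ e.1).2 = 0) : R →+* CentreField e where
  toFun r := ⟨proj e (Ψ.symm (r, 0)), Subring.mem_center_iff.mpr fun y => component_comm Ψ he y _⟩
  map_zero' := Subtype.ext (Subtype.ext (by
    change e.1 * Ψ.symm (0, 0) * e.1 = 0
    rw [← Prod.zero_eq_mk, map_zero, mul_zero, zero_mul]))
  map_one' := Subtype.ext (Subtype.ext (Ψ.injective (by
    change Ψ (e.1 * Ψ.symm (1, 0) * e.1) = Ψ e.1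
    nth_rewrite 3 [← e.2.idem.eq]
    ext1 <;> simp [he])))
  map_add' r s := Subtype.ext (Subtype.ext (Ψ.injective (by
    change Ψ (e.1 * Ψ.symm (r + s, 0) * e.1) =
      Ψ (e.1 * Ψ.symm (r, 0) * e.1 + e.1 * Ψ.symm (s, 0) * e.1)
    ext1 <;> simp [he, mul_add, add_mul])))
  map_mul' r s := Subtype.ext (Subtype.ext (Ψ.injective (by
    change Ψ (e.1 * Ψ.symm (r * s, 0) * e.1) =
      Ψ (e.1 * Ψ.symm (r, 0) * e.1 * (e.1 * Ψ.symm (s, 0) * e.1))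
    have h : (Ψ e.1).1 * (Ψ e.1).1 = (Ψ e.1).1 := by
      rw [← Prod.fst_mul, ← map_mul, e.2.idem.eq]
    ext1
    · simp only [map_mul, Prod.fst_mul, RingEquiv.apply_symm_apply]
      calc (Ψ e.1).1 * (r * s) * (Ψ e.1).1 = ((Ψ e.1).1 * (Ψ e.1).1) * (r * s) := by ring
        _ = (((Ψ e.1).1 * (Ψ e.1).1) * ((Ψ e.1).1 * (Ψ e.1).1)) * (r * s) := by rw [h, h]
        _ = _ := by ring
    · simp [he])))

variable {n : ℕ}

/-- The commutative part of a matrix over `A`. -/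
def commPart (H : Matrix (Fin n) (Fin n) A) : Matrix (Fin n) (Fin n) R := H.map fun x => (Ψ x).1

/-- The matrix part of a matrix over `A`, flattened to a matrix over the base field. -/
def matrixPart (H : Matrix (Fin n) (Fin n) A) : Matrix (Fin n × ι) (Fin n × ι) K :=
  Matrix.of fun i j => (Ψ (H i.1 j.1)).2 i.2 j.2

theorem splitMatrix_matrixComponentEquiv (e : CPI A) (he : Ψ e.1 = (0, 1))
    (H : Matrix (Fin n) (Fin n) A) :
    splitMatrix (matrixComponentEquiv Ψ e he) (matrixProj H e) = matrixPart Ψ H := by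
  ext ⟨i, a⟩ ⟨j, b⟩
  change (Ψ (e.1 * H i j * e.1)).2 a b = (Ψ (H i j)).2 a b
  simp [he]

variable [IsSemisimpleRing A]

theorem splitMatrix_commComponentEquiv {e : CPI A} (he : (Ψ e.1).2 = 0)
    (H : Matrix (Fin n) (Fin n) A) :
    splitMatrix (commComponentEquiv Ψ he) (matrixProj H e) =
      Matrix.reindex (Equiv.prodPUnit _).symm (Equiv.prodPUnit _).symm
        ((commPart Ψ H).map (commComponentHom Ψ he)) := by
  ext1 ⟨i, a⟩ ⟨j, b⟩
  refine Subtype.ext (Subtype.ext (Ψ.injective ?_))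
  change Ψ (e.1 * H i j * e.1) = Ψ (e.1 * Ψ.symm ((Ψ (H i j)).1, 0) * e.1)
  ext1 <;> simp [he]

variable [Nonempty ι]

/-- The reduced norm is computed by determinants over the two factors. -/
theorem apply_reducedNorm (H : Matrix (Fin n) (Fin n) A) :
    Ψ (reducedNorm H) = ((commPart Ψ H).det, Matrix.scalar ι (matrixPart Ψ H).det) := by
  refine Ψ.toEquiv.eq_symm_apply.mp ?_
  refine CPI.ext_of_mul fun e => ?_
  rw [e.mul_reducedNorm]
  apply Ψ.injective
  rcases apply_snd_eq_zero_or Ψ e with he | he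
  · have h := splitMatrix_componentNorm (commComponentEquiv Ψ he) H
    rw [splitMatrix_commComponentEquiv, Matrix.det_reindex_self, ← RingHom.mapMatrix_apply,
      ← RingHom.map_det] at h
    have h' := congrArg (fun z : CentreField e => z.1.1) (congrFun (congrFun h ()) ())
    have h2 : (componentNorm H e).1.1 = e.1 * Ψ.symm ((commPart Ψ H).det, 0) * e.1 := by
      refine h'.trans ?_
      rw [Matrix.scalar_apply, Matrix.diagonal_apply_eq]
      rfl
    rw [h2, ← e.central, mul_assoc, e.2.idem.eq, e.central]
    ext1 <;> simp [he]
  · have h := splitMatrix_componentNorm (matrixComponentEquiv Ψ e he) H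
    rw [splitMatrix_matrixComponentEquiv] at h
    rw [← component_left e (componentNorm H e).1, map_mul, map_mul, he]
    ext1
    · simp
    · refine (one_mul _).trans (Eq.trans ?_ (h.trans ?_))
      · rfl
      · simp

theorem apply_genAdjoint (H : Matrix (Fin n) (Fin n) A) (i j : Fin n) :
    Ψ (genAdjoint H i j) = (charpolyAdjoint (commPart Ψ H) i j,
      Matrix.of fun a b => charpolyAdjoint (matrixPart Ψ H) (i, a) (j, b)) := by
  refine Ψ.toEquiv.eq_symm_apply.mp ?_
  refine CPI.ext_of_mul fun e => ?_
  rw [e.mul_genAdjoint]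
  apply Ψ.injective
  rcases apply_snd_eq_zero_or Ψ e with he | he
  · have h := splitMatrix_componentAdjoint (commComponentEquiv Ψ he) H
    rw [splitMatrix_commComponentEquiv, charpolyAdjoint_reindex, ← charpolyAdjoint_map] at h
    have h' := congrArg (fun z : CentreField e => z.1.1) (congrFun (congrFun h (i, ())) (j, ()))
    have h2 : (componentAdjoint H e i j).1 =
      e.1 * Ψ.symm (charpolyAdjoint (commPart Ψ H) i j, 0) * e.1 := h'
    rw [h2, ← e.central, mul_assoc, e.2.idem.eq, e.central]
    ext1 <;> simp [he]
  · have h := splitMatrix_componentAdjoint (matrixComponentEquiv Ψ e he) H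
    rw [splitMatrix_matrixComponentEquiv] at h
    rw [← component_left e (componentAdjoint H e i j), map_mul, map_mul, he]
    ext1
    · simp
    · ext a b
      rw [Prod.snd_mul, Prod.snd_mul, one_mul, one_mul]
      refine (congrFun (congrFun h (i, a)) (j, b)).trans ?_
      simp

end product

/-! ### The group algebra of the affine group -/

section affine

variable {F : Type*} [Field F]

/-- The multiplier `a` of an affine transformation `x ↦ ax + b`. -/
def multiplier : Aff F →* Fˣ :=
  MonoidHom.toHomUnits
    { toFun := fun g => g.linear 1
      map_one' := rfl
      map_mul' := fun g h => by
        change g.linear (h.linear 1) = _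
        conv_lhs => rw [← mul_one (h.linear 1), ← smul_eq_mul, map_smul, smul_eq_mul, mul_comm] }

theorem aff_apply (g : Aff F) (x : F) : g x = multiplier g * x + g 0 := by
  have h1 : g x = g.linear x + g 0 := by simpa using g.map_vadd 0 x
  have h2 : g.linear x = x * g.linear 1 := by
    conv_lhs => rw [← mul_one x, ← smul_eq_mul, map_smul, smul_eq_mul]
  rw [h1, h2, mul_comm]
  rfl

theorem aff_ext {g h : Aff F} (h1 : multiplier g = multiplier h) (h0 : g 0 = h 0) : g = h :=
  AffineEquiv.ext fun x => by rw [aff_apply g, aff_apply h, h1, h0]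

theorem exists_aff (a : Fˣ) (b : F) : ∃ g : Aff F, multiplier g = a ∧ g 0 = b := by
  let g : Aff F := (LinearEquiv.smulOfUnit a).toAffineEquiv.trans (AffineEquiv.constVAdd F F b)
  refine ⟨g, Units.ext ?_, ?_⟩
  · have h1 := aff_apply g 1
    have h2 : g 1 = b + a := by
      change b + a • (1 : F) = b + a
      rw [Units.smul_def, smul_eq_mul, mul_one]
    have h3 : g 0 = b := by simp [g]
    rw [h2, h3, mul_one, add_comm] at h1
    exact (add_right_cancel h1).symm
  · simp [g]

theorem natCard_aff [Finite F] : Nat.card (Aff F) = Nat.card Fˣ * Nat.card F := by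
  rw [← Nat.card_prod]
  refine Nat.card_congr (Equiv.ofBijective (fun g => (multiplier g, g 0)) ⟨fun g h hgh => ?_, ?_⟩)
  · exact aff_ext (congrArg Prod.fst hgh) (congrArg Prod.snd hgh)
  · rintro ⟨a, b⟩
    obtain ⟨g, h1, h2⟩ := exists_aff a b
    exact ⟨g, Prod.ext h1 h2⟩

variable [Fintype F] [DecidableEq F] (R : Type*) [CommRing R]

/-- The permutation representation of the affine group on functions on the line, modulo the
constants. In the basis of the point masses `δ_a` with `a ≠ 0` one has `δ_0 = -∑ δ_a`, which gives
the entries below. -/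
def standardRep : Aff F →* Matrix {a : F // a ≠ 0} {a : F // a ≠ 0} R where
  toFun g := Matrix.of fun a b => (if a.1 = g b.1 then 1 else 0) - (if 0 = g b.1 then 1 else 0)
  map_one' := by
    ext a b
    simp [Matrix.one_apply, Subtype.ext_iff, b.2.symm]
    congr
  map_mul' g h := by
    ext a b
    -- the summand with `c = 0` vanishes, so the matrix product may be summed over the whole line
    have key := Fintype.sum_eq_add_sum_subtype_ne (fun c : F =>
      ((if a.1 = g c then (1 : R) else 0) - (if 0 = g c then 1 else 0)) *
        ((if c = h b.1 then 1 else 0) - (if 0 = h b.1 then 1 else 0))) 0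
    have hs : ∀ y : F, ∑ c : F, (if y = g c then (1 : R) else 0) = 1 := fun y => by
      rw [Finset.sum_eq_single (g.symm y)] <;> simp +contextual [AffineEquiv.eq_symm_apply, eq_comm]
    simp only [sub_self, mul_zero, zero_add] at key
    rw [Matrix.mul_apply]
    simp only [Matrix.of_apply]
    rw [← key]
    simp only [mul_sub, Finset.sum_sub_distrib, ← Finset.sum_mul, hs, sub_self, zero_mul, sub_zero]
    simp [AffineEquiv.coe_mul]
    congr

theorem standardRep_apply (g : Aff F) (a b : {a : F // a ≠ 0}) :
    standardRep R g a b = (if a.1 = g b.1 then 1 else 0) - (if 0 = g b.1 then 1 else 0) := rfl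

/-- Counting fixed points: `q` for the identity, none for the other translations, and one for all
other affine transformations. -/
theorem sum_fixed_add (g : Aff F) :
    (∑ a : F, if a = g a then (1 : R) else 0) + (if multiplier g = 1 then 1 else 0) =
      1 + if g = 1 then (Fintype.card F : R) else 0 := by
  by_cases hm : multiplier g = 1
  · by_cases h0 : g 0 = 0
    · obtain rfl : g = 1 := aff_ext (by simp [hm]) (by simp [h0])
      simp [add_comm]
    · have h1 : g ≠ 1 := by rintro rfl; exact h0 rfl
      have h2 : ∀ a : F, ¬ (a = g a) := fun a => by
        rw [aff_apply g, hm]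
        simpa using h0
      simp [hm, h1, h2]
  · have h1 : g ≠ 1 := by rintro rfl; exact hm (map_one _)
    have hne : (1 : F) - multiplier g ≠ 0 := fun h => hm (Units.ext (sub_eq_zero.mp h).symm)
    have h2 : ∀ a : F, a = g a ↔ a = g 0 / (1 - multiplier g) := fun a => by
      rw [aff_apply g, eq_div_iff hne]
      constructor <;> intro h <;> linear_combination h
    simp [hm, h1, h2]

theorem trace_standardRep (g : Aff F) :
    (standardRep R g).trace + (if multiplier g = 1 then 1 else 0) =
      if g = 1 then (Fintype.card F : R) else 0 := by
  have key := Fintype.sum_eq_add_sum_subtype_ne (fun a : F =>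
    (if a = g a then (1 : R) else 0) - (if 0 = g a then 1 else 0)) 0
  have hs : ∑ c : F, (if 0 = g c then (1 : R) else 0) = 1 := by
    rw [Finset.sum_eq_single (g.symm 0)] <;> simp +contextual [AffineEquiv.eq_symm_apply, eq_comm]
  rw [Finset.sum_sub_distrib, hs, sub_self, zero_add] at key
  have := sum_fixed_add R g
  simp only [Matrix.trace, Matrix.diag, standardRep_apply]
  rw [← key]
  linear_combination this

variable {K : Type*} [Field K]

variable (F K) in
/-- The group algebra maps to that of the group of multipliers, and to the matrix ring of the
standard representation. -/
def affHom : MonoidAlgebra K (Aff F) →ₐ[K]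
    MonoidAlgebra K Fˣ × Matrix {a : F // a ≠ 0} {a : F // a ≠ 0} K :=
  (MonoidAlgebra.mapDomainAlgHom K K multiplier).prod
    (MonoidAlgebra.lift K _ (Aff F) (standardRep K))

theorem affHom_single (g : Aff F) (r : K) :
    affHom F K (MonoidAlgebra.single g r) =
      (MonoidAlgebra.single (multiplier g) r, r • standardRep K g) := by
  simp [affHom]

/-- The coefficients of an element of the group algebra can be read off from its two images; the
formula is an identity of characters: the trace of the standard representation plus the indicator
function of the translations is `q` times the indicator function of the identity. -/
theorem card_mul_coeff_one (x : MonoidAlgebra K (Aff F)) :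
    (Fintype.card F : K) * x.coeff 1 = (affHom F K x).2.trace + (affHom F K x).1.coeff 1 := by
  induction x using MonoidAlgebra.induction_linear with
  | zero => simp
  | add x y hx hy =>
    simp only [MonoidAlgebra.coeff_add, Finsupp.add_apply, mul_add, hx, hy, map_add, Prod.snd_add,
      Prod.fst_add, Matrix.trace_add]
    ring
  | single g r =>
    have := trace_standardRep K g
    rw [affHom_single, Matrix.trace_smul]
    simp only [MonoidAlgebra.coeff_single, Finsupp.single_apply, smul_eq_mul]
    rw [eq_sub_of_add_eq this]
    split_ifs <;> ring

theorem card_mul_coeff (x : MonoidAlgebra K (Aff F)) (g : Aff F) :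
    (Fintype.card F : K) * x.coeff g =
      (affHom F K (x * MonoidAlgebra.single g⁻¹ 1)).2.trace +
        (affHom F K (x * MonoidAlgebra.single g⁻¹ 1)).1.coeff 1 := by
  rw [← card_mul_coeff_one, MonoidAlgebra.coeff_mul_single_apply]
  simp

theorem affHom_injective (hq : (Fintype.card F : K) ≠ 0) : Function.Injective (affHom F K) := by
  rw [injective_iff_map_eq_zero]
  intro x hx
  ext g
  have h := card_mul_coeff x g
  rw [map_mul, hx, zero_mul] at h
  simpa [hq] using h

theorem affHom_bijective (hq : (Fintype.card F : K) ≠ 0) : Function.Bijective (affHom F K) := by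
  have := Fintype.ofFinite (Aff F)
  have hinj : Function.Injective (affHom F K).toLinearMap := affHom_injective hq
  have : Module.Finite K (MonoidAlgebra K (Aff F)) := .of_basis (MonoidAlgebra.basis (Aff F) K)
  have : Module.Finite K (MonoidAlgebra K Fˣ) := .of_basis (MonoidAlgebra.basis Fˣ K)
  refine ⟨hinj, (LinearMap.injective_iff_surjective_of_finrank_eq_finrank ?_).mp hinj⟩
  have hc : Fintype.card {a : F // a ≠ 0} = Nat.card Fˣ := by
    rw [← Nat.card_eq_fintype_card, Nat.card_congr unitsEquivNeZero]
  rw [Module.finrank_prod, Module.finrank_matrix, Module.finrank_self,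
    Module.finrank_eq_nat_card_basis (MonoidAlgebra.basis (Aff F) K),
    Module.finrank_eq_nat_card_basis (MonoidAlgebra.basis Fˣ K), natCard_aff, hc,
    Nat.card_eq_card_units_add_one F]
  ring

/-- The group algebra of the affine group is the product of a commutative group algebra and a matrix
ring. -/
def affEquiv (hq : (Fintype.card F : K) ≠ 0) : MonoidAlgebra K (Aff F) ≃ₐ[K]
    MonoidAlgebra K Fˣ × Matrix {a : F // a ≠ 0} {a : F // a ≠ 0} K :=
  AlgEquiv.ofBijective (affHom F K) (affHom_bijective hq)

end affine

/-! ### Integrality of traces and of group ring elements -/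

/-- The trace of an integral matrix is a sum of integral eigenvalues. -/
theorem isIntegral_matrix_trace {R K ι : Type*} [CommRing R] [Field K] [Algebra R K] [Fintype ι]
    [DecidableEq ι] [Nonempty ι] {M : Matrix ι ι K} (hM : IsIntegral R M) :
    IsIntegral R M.trace := by
  let L := AlgebraicClosure K
  let N : Matrix ι ι L := M.map (algebraMap K L)
  have hN : IsIntegral R N := hM.map ((IsScalarTower.toAlgHom R K L).mapMatrix)
  have htr : algebraMap K L M.trace = N.trace := AddMonoidHom.map_trace (algebraMap K L) M
  rw [← isIntegral_algebraMap_iff (algebraMap K L).injective, htr,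
    Matrix.trace_eq_sum_roots_charpoly]
  refine IsIntegral.multiset_sum fun r hr => ?_
  have hr' := Matrix.mem_spectrum_of_isRoot_charpoly ((Polynomial.mem_roots'.mp hr).2)
  obtain ⟨f, hf, hfN⟩ := hN
  refine ⟨f, hf, ?_⟩
  -- a monic integral equation for the matrix is one for each of its eigenvalues
  have h := spectrum.subset_polynomial_aeval N (f.map (algebraMap R L)) ⟨r, hr', rfl⟩
  rw [Polynomial.aeval_map_algebraMap, Polynomial.aeval_def, hfN, spectrum.zero_eq] at h
  simpa [Polynomial.eval_map] using h

variable {p : ℕ} [Fact p.Prime]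

theorem mem_padicGroupRing {G : Type*} [Group G] {x : MonoidAlgebra ℚ_[p] G} :
    x ∈ padicGroupRing p G ↔ ∀ g, x.coeff g ∈ (algebraMap ℤ_[p] ℚ_[p]).range := by
  have h := Set.ext_iff.mp
    (MonoidAlgebra.range_map (M := G) (algebraMap ℤ_[p] ℚ_[p]).toAddMonoidHom) x
  exact h

theorem single_mem_padicGroupRing {G : Type*} [Group G] (g : G) :
    MonoidAlgebra.single g 1 ∈ padicGroupRing p G :=
  ⟨MonoidAlgebra.single g 1, by simp⟩

theorem mem_range_of_isIntegral {a : ℚ_[p]} (ha : IsIntegral ℤ_[p] a) :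
    a ∈ (algebraMap ℤ_[p] ℚ_[p]).range :=
  IsIntegrallyClosed.isIntegral_iff.mp ha

theorem trace_leftMulMatrix_monoidAlgebra {C K : Type*} [Group C] [Fintype C] [DecidableEq C]
    [Field K] (x : MonoidAlgebra K C) :
    (Algebra.leftMulMatrix (MonoidAlgebra.basis C K) x).trace = Fintype.card C * x.coeff 1 := by
  induction x using MonoidAlgebra.induction_linear with
  | zero => simp
  | add x y hx hy => simp only [map_add, Matrix.trace_add, hx, hy, MonoidAlgebra.coeff_add,
      Finsupp.add_apply, mul_add]
  | single g r =>
    have h : ∀ c, Algebra.leftMulMatrix (MonoidAlgebra.basis C K) (MonoidAlgebra.single g r) c c =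
        if g = 1 then r else 0 := fun c => by
      rw [Algebra.leftMulMatrix_eq_repr_mul, MonoidAlgebra.basis_apply,
        MonoidAlgebra.single_mul_single]
      change (MonoidAlgebra.single (g * c) (r * 1)).coeff c = _
      simp [Finsupp.single_apply]
    simp [Matrix.trace, h, Finsupp.single_apply]

/-- If `p` does not divide the order of the group `C`, then `ℤ_p[C]` contains all integral elements
of a commutative `ℚ_p[C]`. -/
theorem mem_padicGroupRing_of_isIntegral {C : Type*} [CommGroup C] [Finite C]
    (hC : IsUnit (Nat.card C : ℤ_[p])) {x : MonoidAlgebra ℚ_[p] C} (hx : IsIntegral ℤ_[p] x) :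
    x ∈ padicGroupRing p C := by
  classical
  have := Fintype.ofFinite C
  rw [mem_padicGroupRing]
  intro c
  have hc : IsIntegral ℤ_[p] (MonoidAlgebra.single c⁻¹ (1 : ℚ_[p])) := by
    refine IsIntegral.of_pow (n := Nat.card C) Nat.card_pos ?_
    rw [MonoidAlgebra.single_pow, pow_card_eq_one', one_pow, ← MonoidAlgebra.one_def]
    exact isIntegral_one
  have h := isIntegral_matrix_trace ((hx.mul hc).map
    ((Algebra.leftMulMatrix (MonoidAlgebra.basis C ℚ_[p])).restrictScalars ℤ_[p]))
  change IsIntegral _ (Matrix.trace (Algebra.leftMulMatrix _ _)) at h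
  rw [trace_leftMulMatrix_monoidAlgebra, MonoidAlgebra.coeff_mul_single_apply, inv_inv, one_mul,
    mul_one, ← Nat.card_eq_fintype_card] at h
  obtain ⟨u, hu⟩ := hC
  obtain ⟨z, hz⟩ := mem_range_of_isIntegral h
  refine ⟨(u⁻¹ : (ℤ_[p])ˣ) * z, ?_⟩
  have h1 : algebraMap ℤ_[p] ℚ_[p] (u⁻¹ : (ℤ_[p])ˣ) * (Nat.card C : ℚ_[p]) = 1 := by
    rw [← map_natCast (algebraMap ℤ_[p] ℚ_[p]), ← hu, ← map_mul, Units.inv_mul, map_one]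
  rw [map_mul, hz, ← mul_assoc, h1, one_mul]

/-! ### The split order of the affine group algebra -/

theorem mem_centre {R A : Type*} [Ring A] [CommRing R] [Algebra R A] {Λ : Subalgebra R A} {x : A} :
    x ∈ centre Λ ↔ x ∈ Λ ∧ ∀ y ∈ Λ, y * x = x * y := by
  constructor
  · rintro ⟨x, hx, rfl⟩
    exact ⟨x.2, fun y hy => congrArg Subtype.val (Subalgebra.mem_center_iff.mp hx ⟨y, hy⟩)⟩
  · rintro ⟨hx, h⟩
    exact ⟨⟨x, hx⟩, Subalgebra.mem_center_iff.mpr fun y => Subtype.ext (h y.1 y.2), rfl⟩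

section affine

variable {F : Type*} [Field F] [Fintype F] [DecidableEq F]

variable (p F) in
/-- The order of all elements whose images in `ℚ_p[Fˣ]` and in the matrix ring of the standard
representation are integral. -/
def splitOrder : Subalgebra ℤ_[p] (MonoidAlgebra ℚ_[p] (Aff F)) :=
  ((padicGroupRing p Fˣ).prod (Algebra.ofId ℤ_[p] ℚ_[p]).mapMatrix.range).comap
    ((affHom F ℚ_[p]).restrictScalars ℤ_[p])

theorem mem_splitOrder {x : MonoidAlgebra ℚ_[p] (Aff F)} :
    x ∈ splitOrder p F ↔ (affHom F ℚ_[p] x).1 ∈ padicGroupRing p Fˣ ∧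
      ∀ a b, (affHom F ℚ_[p] x).2 a b ∈ (algebraMap ℤ_[p] ℚ_[p]).range := by
  refine Iff.trans Subalgebra.mem_prod (and_congr Iff.rfl ?_)
  constructor
  · rintro ⟨M, hM⟩ a b
    exact ⟨M a b, congrFun (congrFun hM a) b⟩
  · intro h
    choose M hM using h
    exact ⟨Matrix.of M, by ext a b; exact hM a b⟩

variable (p F) in
/-- The order of all elements whose image in `ℚ_p[Fˣ]` is integral and whose image in the matrix
ring of the standard representation is an integral scalar. -/
def splitCentre : Subalgebra ℤ_[p] (MonoidAlgebra ℚ_[p] (Aff F)) :=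
  ((padicGroupRing p Fˣ).prod ⊥).comap ((affHom F ℚ_[p]).restrictScalars ℤ_[p])

theorem mem_splitCentre {x : MonoidAlgebra ℚ_[p] (Aff F)} :
    x ∈ splitCentre p F ↔ (affHom F ℚ_[p] x).1 ∈ padicGroupRing p Fˣ ∧
      ∃ b : ℤ_[p], (affHom F ℚ_[p] x).2 = Matrix.scalar _ (algebraMap ℤ_[p] ℚ_[p] b) := by
  refine Iff.trans Subalgebra.mem_prod (and_congr Iff.rfl (Algebra.mem_bot.trans ?_))
  exact exists_congr fun b => eq_comm

theorem splitCentre_le : splitCentre p F ≤ splitOrder p F := by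
  intro x hx
  obtain ⟨h1, b, h2⟩ := mem_splitCentre.mp hx
  refine mem_splitOrder.mpr ⟨h1, fun i j => ?_⟩
  rw [h2]
  by_cases hij : i = j
  · subst hij
    simp [-algebraMap_int_eq]
  · simp [hij]

theorem single_mem_splitOrder (g : Aff F) : MonoidAlgebra.single g 1 ∈ splitOrder p F := by
  rw [mem_splitOrder, affHom_single, one_smul]
  refine ⟨single_mem_padicGroupRing _, fun a b => ?_⟩
  change (if a.1 = g b.1 then 1 else 0) - (if 0 = g b.1 then 1 else 0) ∈
    (algebraMap ℤ_[p] ℚ_[p]).range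
  refine sub_mem ?_ ?_ <;> split_ifs <;> first | exact one_mem _ | exact zero_mem _

theorem padicGroupRing_le_splitOrder : padicGroupRing p (Aff F) ≤ splitOrder p F := by
  rintro _ ⟨y, rfl⟩
  induction y using MonoidAlgebra.induction_linear with
  | zero => rw [map_zero]; exact zero_mem _
  | add x y hx hy => rw [map_add]; exact add_mem hx hy
  | single g r =>
    have : (MonoidAlgebra.mapAlgHom (Aff F) (Algebra.ofId ℤ_[p] ℚ_[p]))
        (MonoidAlgebra.single g r) = r • MonoidAlgebra.single g (1 : ℚ_[p]) := by
      rw [MonoidAlgebra.mapAlgHom_single, MonoidAlgebra.smul_single, Algebra.smul_def, mul_one]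
      rfl
    change (MonoidAlgebra.mapAlgHom (Aff F) (Algebra.ofId ℤ_[p] ℚ_[p])) _ ∈ _
    rw [this]
    exact Subalgebra.smul_mem _ (single_mem_splitOrder g) r

/-- The criterion for integrality of group ring elements that follows from `card_mul_coeff`. -/
theorem card_smul_mem {Γ : Subalgebra ℤ_[p] (MonoidAlgebra ℚ_[p] (Aff F))}
    (hΓ : padicGroupRing p (Aff F) ≤ Γ)
    (h : ∀ y ∈ Γ, (affHom F ℚ_[p] y).2.trace + (affHom F ℚ_[p] y).1.coeff 1 ∈
      (algebraMap ℤ_[p] ℚ_[p]).range) {x : MonoidAlgebra ℚ_[p] (Aff F)} (hx : x ∈ Γ) :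
    (Fintype.card F : ℤ_[p]) • x ∈ padicGroupRing p (Aff F) := by
  rw [mem_padicGroupRing]
  intro g
  rw [MonoidAlgebra.coeff_smul_apply, Algebra.smul_def, map_natCast, card_mul_coeff]
  exact h _ (mul_mem hx (hΓ (single_mem_padicGroupRing _)))

theorem card_smul_mem_of_mem_splitOrder {x : MonoidAlgebra ℚ_[p] (Aff F)}
    (hx : x ∈ splitOrder p F) : (Fintype.card F : ℤ_[p]) • x ∈ padicGroupRing p (Aff F) := by
  refine card_smul_mem padicGroupRing_le_splitOrder (fun y hy => ?_) hx
  obtain ⟨h1, h2⟩ := mem_splitOrder.mp hy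
  exact add_mem (sum_mem fun a _ => h2 a a) (mem_padicGroupRing.mp h1 1)

theorem card_ne_zero_padic {F : Type*} [Field F] [Fintype F] : (Fintype.card F : ℚ_[p]) ≠ 0 := by
  exact_mod_cast Fintype.card_ne_zero

variable (p F) in
/-- The decomposition of the group algebra over `ℚ_p`. -/
def affEquivPadic : MonoidAlgebra ℚ_[p] (Aff F) ≃+*
    MonoidAlgebra ℚ_[p] Fˣ × Matrix {a : F // a ≠ 0} {a : F // a ≠ 0} ℚ_[p] :=
  (affEquiv card_ne_zero_padic).toRingEquiv

theorem affEquivPadic_apply (x : MonoidAlgebra ℚ_[p] (Aff F)) :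
    affEquivPadic p F x = affHom F ℚ_[p] x := rfl

instance instNonemptyNeZero : Nonempty {a : F // a ≠ 0} := ⟨⟨1, one_ne_zero⟩⟩

/-- Elements of the split centre are central in the group algebra. -/
theorem mul_comm_of_mem_splitCentre {x : MonoidAlgebra ℚ_[p] (Aff F)} (hx : x ∈ splitCentre p F)
    (y : MonoidAlgebra ℚ_[p] (Aff F)) : y * x = x * y := by
  obtain ⟨-, b, hb⟩ := mem_splitCentre.mp hx
  apply affHom_injective card_ne_zero_padic
  rw [map_mul, map_mul]
  refine Prod.ext (mul_comm _ _) ?_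
  rw [Prod.snd_mul, Prod.snd_mul, hb]
  exact ((Matrix.scalar_commute _ (fun r' => Commute.all _ r') _).eq).symm

/-- An element commuting with the group acts as a scalar in the standard representation. -/
theorem exists_eq_scalar {x : MonoidAlgebra ℚ_[p] (Aff F)}
    (hx : ∀ g : Aff F, MonoidAlgebra.single g 1 * x = x * MonoidAlgebra.single g 1) :
    ∃ b, (affHom F ℚ_[p] x).2 = Matrix.scalar _ b := by
  have hc : ∀ y, y * x = x * y := fun y => by
    induction y using MonoidAlgebra.induction_linear with
    | zero => simp
    | add y z hy hz => rw [add_mul, mul_add, hy, hz]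
    | single g r =>
      have : MonoidAlgebra.single g r = r • MonoidAlgebra.single g (1 : ℚ_[p]) := by simp
      rw [this, smul_mul_assoc, mul_smul_comm, hx]
  have hz : (affHom F ℚ_[p] x).2 ∈ Set.range (Matrix.scalar {a : F // a ≠ 0}) := by
    refine Matrix.mem_range_scalar_of_commute_single fun i j _ => ?_
    have := congrArg (fun x => (affEquivPadic p F x).2)
      (hc ((affEquivPadic p F).symm (0, Matrix.single i j 1)))
    simpa [Commute, SemiconjBy, ← affEquivPadic_apply] using this
  obtain ⟨b, hb⟩ := hz
  exact ⟨b, hb.symm⟩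

theorem centre_padicGroupRing_le : centre (padicGroupRing p (Aff F)) ≤ splitCentre p F := by
  intro x hx
  obtain ⟨hx1, hx2⟩ := mem_centre.mp hx
  obtain ⟨h1, h2⟩ := mem_splitOrder.mp (padicGroupRing_le_splitOrder hx1)
  obtain ⟨b, hb⟩ := exists_eq_scalar fun g => hx2 _ (single_mem_padicGroupRing g)
  obtain ⟨c, hc⟩ := h2 ⟨1, one_ne_zero⟩ ⟨1, one_ne_zero⟩
  refine mem_splitCentre.mpr ⟨h1, c, ?_⟩
  rw [hb] at hc ⊢
  rw [hc]
  simp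

/-! ### Reduced norms and generalised adjoints of integral matrices -/

theorem exists_commPart_eq_map {n : ℕ} {H : Matrix (Fin n) (Fin n) (MonoidAlgebra ℚ_[p] (Aff F))}
    (hH : HasEntriesIn (splitOrder p F) H) :
    ∃ N : Matrix (Fin n) (Fin n) (MonoidAlgebra ℤ_[p] Fˣ),
      commPart (affEquivPadic p F) H =
        N.map (MonoidAlgebra.mapAlgHom Fˣ (Algebra.ofId ℤ_[p] ℚ_[p]) :
          MonoidAlgebra ℤ_[p] Fˣ →+* MonoidAlgebra ℚ_[p] Fˣ) := by
  have h : ∀ i j, ∃ y, MonoidAlgebra.mapAlgHom Fˣ (Algebra.ofId ℤ_[p] ℚ_[p]) y =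
      (affHom F ℚ_[p] (H i j)).1 := fun i j => (mem_splitOrder.mp (hH i j)).1
  choose N hN using h
  exact ⟨Matrix.of N, by ext1 i j; exact (hN i j).symm⟩

theorem exists_matrixPart_eq_map {n : ℕ} {H : Matrix (Fin n) (Fin n) (MonoidAlgebra ℚ_[p] (Aff F))}
    (hH : HasEntriesIn (splitOrder p F) H) :
    ∃ N : Matrix (Fin n × {a : F // a ≠ 0}) (Fin n × {a : F // a ≠ 0}) ℤ_[p],
      matrixPart (affEquivPadic p F) H = N.map (algebraMap ℤ_[p] ℚ_[p]) := by
  have h : ∀ i j : Fin n × {a : F // a ≠ 0}, ∃ y, algebraMap ℤ_[p] ℚ_[p] y =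
      (affHom F ℚ_[p] (H i.1 j.1)).2 i.2 j.2 :=
    fun i j => (mem_splitOrder.mp (hH i.1 j.1)).2 i.2 j.2
  choose N hN using h
  exact ⟨Matrix.of N, by ext1 i j; exact (hN i j).symm⟩

theorem reducedNorm_mem_splitCentre {n : ℕ}
    {H : Matrix (Fin n) (Fin n) (MonoidAlgebra ℚ_[p] (Aff F))}
    (hH : HasEntriesIn (splitOrder p F) H) : reducedNorm H ∈ splitCentre p F := by
  obtain ⟨N, hN⟩ := exists_commPart_eq_map hH
  obtain ⟨M, hM⟩ := exists_matrixPart_eq_map hH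
  rw [mem_splitCentre, ← affEquivPadic_apply, apply_reducedNorm, hN, hM, ← RingHom.mapMatrix_apply,
    ← RingHom.mapMatrix_apply, ← RingHom.map_det, ← RingHom.map_det]
  exact ⟨⟨N.det, rfl⟩, M.det, rfl⟩

theorem genAdjoint_mem_splitOrder {n : ℕ}
    {H : Matrix (Fin n) (Fin n) (MonoidAlgebra ℚ_[p] (Aff F))}
    (hH : HasEntriesIn (splitOrder p F) H) : HasEntriesIn (splitOrder p F) (genAdjoint H) := by
  obtain ⟨N, hN⟩ := exists_commPart_eq_map hH
  obtain ⟨M, hM⟩ := exists_matrixPart_eq_map hH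
  intro i j
  rw [mem_splitOrder, ← affEquivPadic_apply, apply_genAdjoint, hN, hM, ← charpolyAdjoint_map,
    ← charpolyAdjoint_map]
  exact ⟨⟨charpolyAdjoint N i j, rfl⟩, fun a b => ⟨charpolyAdjoint M (i, a) (j, b), rfl⟩⟩

/-- The generalised adjoint inverts a matrix up to its reduced norm. -/
theorem genAdjoint_mul {n : ℕ} (H : Matrix (Fin n) (Fin n) (MonoidAlgebra ℚ_[p] (Aff F))) :
    genAdjoint H * H = Matrix.diagonal fun _ => reducedNorm H := by
  ext1 i j
  apply (affEquivPadic p F).injective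
  rw [Matrix.mul_apply, map_sum]
  simp only [map_mul, apply_genAdjoint]
  have hc := congrFun (congrFun (charpolyAdjoint_mul (commPart (affEquivPadic p F) H)) i) j
  have hm := charpolyAdjoint_mul (matrixPart (affEquivPadic p F) H)
  rw [Matrix.mul_apply] at hc
  by_cases hij : i = j
  · subst hij
    rw [Matrix.diagonal_apply_eq, apply_reducedNorm]
    refine Prod.ext ?_ ?_
    · rw [Prod.fst_sum]
      simpa [commPart] using hc
    · ext a b
      have hab := congrFun (congrFun hm (i, a)) (i, b)
      rw [Matrix.mul_apply, Fintype.sum_prod_type] at hab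
      rw [Prod.snd_sum, Matrix.sum_apply]
      simp only [Prod.snd_mul, Matrix.mul_apply]
      refine hab.trans ?_
      by_cases h : a = b <;> simp [h]
  · rw [Matrix.diagonal_apply_ne _ hij, map_zero]
    refine Prod.ext ?_ ?_
    · rw [Prod.fst_sum]
      simpa [commPart, hij] using hc
    · ext a b
      have hab := congrFun (congrFun hm (i, a)) (j, b)
      rw [Matrix.mul_apply, Fintype.sum_prod_type] at hab
      rw [Prod.snd_sum, Matrix.sum_apply]
      simp only [Prod.snd_mul, Matrix.mul_apply]
      refine hab.trans ?_
      simp [hij]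

theorem affHom_reducedNorm_one (x : MonoidAlgebra ℚ_[p] (Aff F)) :
    affHom F ℚ_[p] (reducedNorm (Matrix.of fun _ _ : Fin 1 => x)) =
      ((affHom F ℚ_[p] x).1, Matrix.scalar _ (affHom F ℚ_[p] x).2.det) := by
  rw [← affEquivPadic_apply, apply_reducedNorm]
  refine Prod.ext ?_ (congrArg (Matrix.scalar _) ?_)
  · simp [commPart, affEquivPadic_apply]
  · rw [← Matrix.det_reindex_self (Equiv.uniqueProd {a : F // a ≠ 0} (Fin 1))]
    congr 1

/-! ### The norm ideal and the denominator ideal -/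

theorem reducedNorm_mem_normIdeal {F : Type*} [Field F] [Fintype F] {n : ℕ} (hn : 0 < n)
    {H : Matrix (Fin n) (Fin n) (MonoidAlgebra ℚ_[p] (Aff F))}
    (hH : HasEntriesIn (padicGroupRing p (Aff F)) H) :
    reducedNorm H ∈ normIdeal (padicGroupRing p (Aff F)) :=
  Submodule.subset_span ⟨n, hn, H, hH, rfl⟩

/-- The reduced norms of elements of the group ring, described by their images. -/
theorem mem_normIdeal_of_affHom_eq {x y : MonoidAlgebra ℚ_[p] (Aff F)}
    (hx : x ∈ padicGroupRing p (Aff F))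
    (hy : affHom F ℚ_[p] y = ((affHom F ℚ_[p] x).1, Matrix.scalar _ (affHom F ℚ_[p] x).2.det)) :
    y ∈ normIdeal (padicGroupRing p (Aff F)) := by
  rw [← affHom_reducedNorm_one] at hy
  rw [affHom_injective card_ne_zero_padic hy]
  exact reducedNorm_mem_normIdeal one_pos fun _ _ => hx

theorem one_mem_normIdeal : 1 ∈ normIdeal (padicGroupRing p (Aff F)) :=
  mem_normIdeal_of_affHom_eq (one_mem _) (by
    rw [map_one]
    exact Prod.ext rfl (by simp))

theorem centre_le_normIdeal : Subalgebra.toSubmodule (centre (padicGroupRing p (Aff F))) ≤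
    normIdeal (padicGroupRing p (Aff F)) := by
  intro x hx
  have h := Submodule.smul_mem (Submodule.span (centre (padicGroupRing p (Aff F))) _)
    (⟨x, hx⟩ : centre (padicGroupRing p (Aff F))) (one_mem_normIdeal (p := p) (F := F))
  rw [Subalgebra.smul_def, smul_eq_mul, mul_one] at h
  exact h

/-- To bound the norm ideal by an algebra, it suffices to consider the generators. -/
theorem normIdeal_le {F : Type*} [Field F] [Fintype F]
    {Γ : Subalgebra ℤ_[p] (MonoidAlgebra ℚ_[p] (Aff F))}
    (hΓ : centre (padicGroupRing p (Aff F)) ≤ Γ)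
    (h : ∀ (n : ℕ) (H : Matrix (Fin n) (Fin n) (MonoidAlgebra ℚ_[p] (Aff F))),
      HasEntriesIn (padicGroupRing p (Aff F)) H → reducedNorm H ∈ Γ) :
    normIdeal (padicGroupRing p (Aff F)) ≤ Subalgebra.toSubmodule Γ := by
  intro x hx
  change x ∈ Submodule.span _ _ at hx
  induction hx using Submodule.span_induction with
  | mem x hx =>
    obtain ⟨n, -, H, hH, rfl⟩ := hx
    exact h n H hH
  | zero => exact zero_mem _
  | add x y _ _ hx hy => exact add_mem hx hy
  | smul c x _ hx => exact Γ.mul_mem (hΓ c.2) hx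

theorem normIdeal_le_splitCentre :
    normIdeal (padicGroupRing p (Aff F)) ≤ Subalgebra.toSubmodule (splitCentre p F) :=
  normIdeal_le centre_padicGroupRing_le fun _ _ hH =>
    reducedNorm_mem_splitCentre fun i j => padicGroupRing_le_splitOrder (hH i j)

/-- Elements of the denominator ideal multiply the norm ideal into the group ring, since the
generalised adjoint inverts a matrix up to its reduced norm. -/
theorem mul_mem_of_mem_denominatorIdeal {x y : MonoidAlgebra ℚ_[p] (Aff F)}
    (hx : x ∈ denominatorIdeal (padicGroupRing p (Aff F)))
    (hy : y ∈ normIdeal (padicGroupRing p (Aff F))) : x * y ∈ padicGroupRing p (Aff F) := by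
  change y ∈ Submodule.span _ _ at hy
  induction hy using Submodule.span_induction with
  | mem y hy =>
    obtain ⟨n, hn, H, hH, rfl⟩ := hy
    let i : Fin n := ⟨0, hn⟩
    have h : reducedNorm H = (genAdjoint H * H) i i := by
      rw [genAdjoint_mul, Matrix.diagonal_apply_eq]
    rw [h, Matrix.mul_apply, Finset.mul_sum]
    refine sum_mem fun k _ => ?_
    rw [← mul_assoc]
    exact mul_mem (hx.2 n hn H hH i k) (hH k i)
  | zero => rw [mul_zero]; exact zero_mem _
  | add y z _ _ hy hz => rw [mul_add]; exact add_mem hy hz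
  | smul c y _ hy =>
    obtain ⟨hc, hcc⟩ := mem_centre.mp c.2
    obtain ⟨hx1, -⟩ := mem_centre.mp hx.1
    rw [Subalgebra.smul_def, smul_eq_mul, ← mul_assoc, hcc x hx1, mul_assoc]
    exact mul_mem hc hy

/-- If `q` is a unit, then the group ring is the full split order, which contains all generalised
adjoints of its matrices. -/
theorem denominatorIdeal_eq_and_normIdeal_eq_of_isUnit (hq : IsUnit (Fintype.card F : ℤ_[p])) :
    denominatorIdeal (padicGroupRing p (Aff F)) =
        Subalgebra.toSubmodule (centre (padicGroupRing p (Aff F))) ∧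
      normIdeal (padicGroupRing p (Aff F)) =
        Subalgebra.toSubmodule (centre (padicGroupRing p (Aff F))) := by
  have hle : splitOrder p F ≤ padicGroupRing p (Aff F) := by
    intro x hx
    obtain ⟨u, hu⟩ := hq
    have h := card_smul_mem_of_mem_splitOrder hx
    have h2 := Subalgebra.smul_mem _ h (u⁻¹ : (ℤ_[p])ˣ).1
    rwa [← hu, smul_smul, Units.inv_mul, one_smul] at h2
  refine ⟨le_antisymm (fun x hx => hx.1) fun x hx => ⟨hx, fun n _ H hH i j => ?_⟩,
    le_antisymm (normIdeal_le le_rfl fun n H hH => ?_) centre_le_normIdeal⟩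
  · exact mul_mem (mem_centre.mp hx).1
      (hle (genAdjoint_mem_splitOrder (fun i j => padicGroupRing_le_splitOrder (hH i j)) i j))
  · have h := reducedNorm_mem_splitCentre fun i j => padicGroupRing_le_splitOrder (hH i j)
    exact mem_centre.mpr ⟨hle (splitCentre_le h), fun y _ => mul_comm_of_mem_splitCentre h y⟩

/-! ### Twice the split centre -/

variable (p) in
/-- The element of the group algebra that maps to `c` in `ℚ_p[Fˣ]` and acts as zero in the standard
representation. -/
def unitLift (c : Fˣ) : MonoidAlgebra ℚ_[p] (Aff F) :=
  (affEquivPadic p F).symm (MonoidAlgebra.single c 1, 0)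

theorem affHom_unitLift (c : Fˣ) :
    affHom F ℚ_[p] (unitLift p c) = (MonoidAlgebra.single c 1, 0) :=
  (affEquivPadic p F).apply_symm_apply _

theorem unitLift_mem (c : Fˣ) : unitLift p c ∈ splitCentre p F := by
  rw [mem_splitCentre, affHom_unitLift]
  exact ⟨single_mem_padicGroupRing c, 0, by simp⟩

theorem splitCentre_le_of_unitLift_mem (N : Submodule ℤ_[p] (MonoidAlgebra ℚ_[p] (Aff F)))
    (h1 : 1 ∈ N) (hN : ∀ c : Fˣ, unitLift p c ∈ N) :
    Subalgebra.toSubmodule (splitCentre p F) ≤ N := by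
  intro x hx
  obtain ⟨hx1, b, hb⟩ := mem_splitCentre.mp hx
  rw [mem_padicGroupRing] at hx1
  choose y hy using hx1
  have key : x = ∑ c, y c • unitLift p c + b • (1 - unitLift p 1) := by
    apply affHom_injective (card_ne_zero_padic (p := p))
    have hs : ∀ (r : ℤ_[p]) (z : MonoidAlgebra ℚ_[p] (Aff F)),
        affHom F ℚ_[p] (r • z) = r • affHom F ℚ_[p] z :=
      fun r z => map_smul ((affHom F ℚ_[p]).restrictScalars ℤ_[p]) r z
    rw [map_add, map_sum, hs, map_sub, map_one, affHom_unitLift]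
    simp only [hs, affHom_unitLift]
    refine Prod.ext ?_ ?_
    · rw [Prod.fst_add, Prod.fst_sum]
      ext c
      rw [← hy]
      simp [Algebra.smul_def, Finsupp.single_apply, MonoidAlgebra.one_def]
    · rw [Prod.snd_add, Prod.snd_sum, hb]
      ext i j
      by_cases hij : i = j <;> simp [hij, Matrix.smul_apply, Algebra.smul_def (A := ℚ_[p])]
  rw [key]
  exact add_mem (sum_mem fun c _ => N.smul_mem _ (hN c)) (N.smul_mem _ (sub_mem h1 (hN 1)))

theorem splitCentre_fg : (Subalgebra.toSubmodule (splitCentre p F)).FG := by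
  refine Submodule.FG.of_le (T := Submodule.span ℤ_[p] (insert 1 (Set.range (unitLift p))))
    (Submodule.fg_span ((Set.finite_range _).insert _)) ?_
  exact splitCentre_le_of_unitLift_mem _ (Submodule.subset_span (Set.mem_insert _ _))
    fun c => Submodule.subset_span (Set.mem_insert_of_mem _ ⟨c, rfl⟩)

/-- A translation of order two acts on the standard representation with eigenvalue `-1`. -/
theorem det_one_add_standardRep {t : Aff F} (ht : t * t = 1) (ht1 : t ≠ 1)
    (hm : multiplier t = 1) : (1 + standardRep ℚ_[p] t).det = 0 := by
  by_contra h
  have hu : IsUnit (1 + standardRep ℚ_[p] t) :=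
    (Matrix.isUnit_iff_isUnit_det _).mpr (isUnit_iff_ne_zero.mpr h)
  have h0 : (1 + standardRep ℚ_[p] t) * (1 - standardRep ℚ_[p] t) = 0 := by
    have : standardRep ℚ_[p] t * standardRep ℚ_[p] t = 1 := by rw [← map_mul, ht, map_one]
    rw [add_mul, mul_sub, mul_sub, this]
    simp
  have h1 : standardRep ℚ_[p] t = standardRep ℚ_[p] 1 := by
    rw [map_one]
    exact (sub_eq_zero.mp ((hu.mul_right_eq_zero).mp h0)).symm
  have h2 := trace_standardRep ℚ_[p] t
  have h3 := trace_standardRep ℚ_[p] (1 : Aff F)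
  rw [if_pos hm, if_neg ht1, h1] at h2
  rw [if_pos (map_one _), if_pos rfl, h2] at h3
  exact card_ne_zero_padic h3.symm

/-- Let `g` have multiplier `c`. Twice the lift of `c` is `nr(g) - nr(-g)` if `q` is odd, because
the standard representation then has even degree, and it is `nr(g (1 + t))` with a translation `t` of
order two if `q` is even. -/
theorem two_smul_unitLift_mem (c : Fˣ) :
    (2 : ℤ_[p]) • unitLift p c ∈ normIdeal (padicGroupRing p (Aff F)) := by
  obtain ⟨g, rfl, -⟩ := exists_aff c 0
  have h2 : affHom F ℚ_[p] ((2 : ℤ_[p]) • unitLift p (multiplier g)) =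
      (MonoidAlgebra.single (multiplier g) 1 + MonoidAlgebra.single (multiplier g) 1, 0) := by
    rw [two_smul, map_add, affHom_unitLift]
    exact Prod.ext rfl (add_zero _)
  by_cases hF : (2 : F) = 0
  · obtain ⟨t, hm, ht0⟩ := exists_aff (1 : Fˣ) (1 : F)
    have ht1 : t ≠ 1 := by
      rintro rfl
      exact zero_ne_one ht0
    have htt : t * t = 1 := by
      refine aff_ext (by rw [map_mul, hm, mul_one, map_one]) ?_
      change t (t 0) = 0
      rw [aff_apply t (t 0), hm, ht0, Units.val_one, one_mul, one_add_one_eq_two, hF]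
    refine mem_normIdeal_of_affHom_eq
      (x := MonoidAlgebra.single g 1 * (1 + MonoidAlgebra.single t 1))
      (mul_mem (single_mem_padicGroupRing _) (add_mem (one_mem _) (single_mem_padicGroupRing _))) ?_
    rw [h2, map_mul, map_add, map_one, affHom_single, affHom_single, one_smul, one_smul, hm]
    refine Prod.ext ?_ ?_
    · simp [mul_add, MonoidAlgebra.single_mul_single]
    · simp only [Prod.snd_mul, Prod.snd_add, Prod.snd_one, Matrix.det_mul,
        det_one_add_standardRep htt ht1 hm, mul_zero, map_zero]
  · have hodd : Even (Fintype.card {a : F // a ≠ 0}) := by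
      have h := FiniteField.odd_card_of_char_ne_two (F := F) fun h => hF (by
        have := CharP.cast_eq_zero F (ringChar F)
        rw [h] at this
        exact_mod_cast this)
      have hc : Fintype.card {a : F // a ≠ 0} + 1 = Fintype.card F := by
        rw [Fintype.card_eq_card_units_add_one (α := F), Fintype.card_congr unitsEquivNeZero]
      rw [Nat.even_iff]
      omega
    have hs : ∀ s : ℚ_[p], s * s = 1 → (affEquivPadic p F).symm
        (MonoidAlgebra.single (multiplier g) s, Matrix.scalar _ (standardRep ℚ_[p] g).det) ∈
          normIdeal (padicGroupRing p (Aff F)) := by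
      intro s hs
      have hs' : s = 1 ∨ s = -1 := mul_self_eq_one_iff.mp hs
      refine mem_normIdeal_of_affHom_eq (x := MonoidAlgebra.single g s) ?_ ?_
      · rcases hs' with rfl | rfl
        · exact single_mem_padicGroupRing _
        · rw [MonoidAlgebra.single_neg]
          exact neg_mem (single_mem_padicGroupRing _)
      · rw [← affEquivPadic_apply, RingEquiv.apply_symm_apply, affHom_single]
        obtain ⟨k, hk⟩ := hodd
        rw [Matrix.det_smul, hk, pow_add, ← mul_pow, hs, one_pow, one_mul]
    have h := sub_mem (hs 1 (one_mul 1)) (hs (-1) (by ring))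
    rw [← map_sub] at h
    convert h
    apply (affEquivPadic p F).injective
    rw [RingEquiv.apply_symm_apply, affEquivPadic_apply, h2]
    refine Prod.ext ?_ ?_
    · simp [MonoidAlgebra.single_neg]
    · simp

theorem two_smul_mem_normIdeal {x : MonoidAlgebra ℚ_[p] (Aff F)} (hx : x ∈ splitCentre p F) :
    (2 : ℤ_[p]) • x ∈ normIdeal (padicGroupRing p (Aff F)) := by
  have h := splitCentre_le_of_unitLift_mem
    ((normIdeal (padicGroupRing p (Aff F))).comap (LinearMap.lsmul ℤ_[p] _ 2))
    (Submodule.smul_mem _ (2 : ℤ_[p]) one_mem_normIdeal) two_smul_unitLift_mem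
  exact h hx

/-! ### Maximal orders -/

theorem isIntegral_of_mem_isOrder {A : Type*} [Ring A] [Algebra ℚ_[p] A] [Algebra ℤ_[p] A]
    [IsScalarTower ℤ_[p] ℚ_[p] A] {M : Subalgebra ℤ_[p] A} (hM : IsOrder ℚ_[p] M) {x : A}
    (hx : x ∈ M) : IsIntegral ℤ_[p] x :=
  IsIntegral.of_mem_of_fg M hM.fg x hx

/-- A maximal order contains every finitely generated algebra of central elements, since adjoining
it gives an order again. -/
theorem IsMaximalOrder.le_of_central {A : Type*} [Ring A] [Algebra ℚ_[p] A] [Algebra ℤ_[p] A]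
    [IsScalarTower ℤ_[p] ℚ_[p] A] {M Z : Subalgebra ℤ_[p] A} (hM : IsMaximalOrder ℚ_[p] M)
    (hZ : (Subalgebra.toSubmodule Z).FG) (hc : ∀ z ∈ Z, ∀ y, y * z = z * y) : Z ≤ M := by
  let P := Subalgebra.toSubmodule M * Subalgebra.toSubmodule Z
  have hMP : ∀ x ∈ M, x ∈ P := fun x hx => by
    simpa using Submodule.mul_mem_mul (M := Subalgebra.toSubmodule M)
      (N := Subalgebra.toSubmodule Z) hx (one_mem Z)
  have hZP : ∀ x ∈ Z, x ∈ P := fun x hx => by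
    simpa using Submodule.mul_mem_mul (M := Subalgebra.toSubmodule M)
      (N := Subalgebra.toSubmodule Z) (one_mem M) hx
  have hmul : ∀ x y, x ∈ P → y ∈ P → x * y ∈ P := by
    intro x y hx hy
    induction hx using Submodule.mul_induction_on' with
    | mem_mul_mem m hm z hz =>
      induction hy using Submodule.mul_induction_on' with
      | mem_mul_mem m' hm' z' hz' =>
        have : m * z * (m' * z') = (m * m') * (z * z') := by
          rw [mul_assoc, ← mul_assoc z, ← hc z hz m', mul_assoc, mul_assoc]
        rw [this]
        exact Submodule.mul_mem_mul (M.mul_mem hm hm') (Z.mul_mem hz hz')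
      | add a _ b _ ha hb => rw [mul_add]; exact add_mem ha hb
    | add a _ b _ ha hb => rw [add_mul]; exact add_mem ha hb
  let Γ : Subalgebra ℤ_[p] A := P.toSubalgebra (hMP 1 (one_mem M)) hmul
  have hΓ : IsOrder ℚ_[p] Γ :=
    { fg := Submodule.FG.mul hM.prop.fg hZ
      span_eq_top := by
        rw [eq_top_iff, ← hM.prop.span_eq_top]
        exact Submodule.span_mono hMP }
  exact fun z hz => hM.le_of_ge hΓ hMP (hZP z hz)

variable {M : Subalgebra ℤ_[p] (MonoidAlgebra ℚ_[p] (Aff F))}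

theorem isIntegral_affHom (hM : IsOrder ℚ_[p] M) {x : MonoidAlgebra ℚ_[p] (Aff F)} (hx : x ∈ M) :
    IsIntegral ℤ_[p] (affHom F ℚ_[p] x).1 ∧ IsIntegral ℤ_[p] (affHom F ℚ_[p] x).2 :=
  ⟨(isIntegral_of_mem_isOrder hM hx).map
      ((AlgHom.fst ℚ_[p] _ _).comp (affHom F ℚ_[p]) |>.restrictScalars ℤ_[p]),
    (isIntegral_of_mem_isOrder hM hx).map
      ((AlgHom.snd ℚ_[p] _ _).comp (affHom F ℚ_[p]) |>.restrictScalars ℤ_[p])⟩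

/-- A central element of a maximal order is integral, so its two images are; conversely the maximal
order absorbs the split centre. -/
theorem centre_eq_splitCentre (hu : IsUnit (Nat.card Fˣ : ℤ_[p])) (hM : IsMaximalOrder ℚ_[p] M)
    (hle : padicGroupRing p (Aff F) ≤ M) : centre M = splitCentre p F := by
  apply le_antisymm
  · intro x hx
    obtain ⟨hxM, hxc⟩ := mem_centre.mp hx
    obtain ⟨h1, h2⟩ := isIntegral_affHom hM.prop hxM
    obtain ⟨b, hb⟩ := exists_eq_scalar fun g => hxc _ (hle (single_mem_padicGroupRing g))
    rw [hb] at h2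
    have h3 : IsIntegral ℤ_[p] b :=
      (isIntegral_algebraMap_iff (A := ℚ_[p]) (FaithfulSMul.algebraMap_injective ℚ_[p]
        (Matrix {a : F // a ≠ 0} {a : F // a ≠ 0} ℚ_[p]))).mp h2
    obtain ⟨c, hc⟩ := mem_range_of_isIntegral h3
    exact mem_splitCentre.mpr ⟨mem_padicGroupRing_of_isIntegral hu h1, c, by rw [hb, hc]⟩
  · intro x hx
    exact mem_centre.mpr ⟨hM.le_of_central splitCentre_fg
      (fun z hz => mul_comm_of_mem_splitCentre hz) hx, fun y _ => mul_comm_of_mem_splitCentre hx y⟩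

theorem card_smul_mem_of_mem_order (hu : IsUnit (Nat.card Fˣ : ℤ_[p])) (hM : IsOrder ℚ_[p] M)
    (hle : padicGroupRing p (Aff F) ≤ M) {x : MonoidAlgebra ℚ_[p] (Aff F)} (hx : x ∈ M) :
    (Fintype.card F : ℤ_[p]) • x ∈ padicGroupRing p (Aff F) := by
  refine card_smul_mem hle (fun y hy => ?_) hx
  obtain ⟨h1, h2⟩ := isIntegral_affHom hM hy
  exact add_mem (mem_range_of_isIntegral (isIntegral_matrix_trace h2))
    (mem_padicGroupRing.mp (mem_padicGroupRing_of_isIntegral hu h1) 1)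

/-- If the components of a central element in both factors lie in the group ring, then the element
is divisible by `q`, by the formula `card_mul_coeff` for the coefficients of these components. -/
theorem exists_eq_card_smul (hu : IsUnit (Nat.card Fˣ : ℤ_[p])) {x : MonoidAlgebra ℚ_[p] (Aff F)}
    (hx : x ∈ splitCentre p F) (hx1 : x ∈ padicGroupRing p (Aff F))
    (hx2 : x * unitLift p 1 ∈ padicGroupRing p (Aff F)) :
    ∃ z ∈ splitCentre p F, x = (Fintype.card F : ℤ_[p]) • z := by
  obtain ⟨-, b, hb⟩ := mem_splitCentre.mp hx
  have hq : (Fintype.card F : ℚ_[p]) ≠ 0 := card_ne_zero_padic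
  refine ⟨(Fintype.card F : ℚ_[p])⁻¹ • x, mem_splitCentre.mpr ⟨?_, ?_⟩, ?_⟩
  · rw [mem_padicGroupRing]
    intro c
    obtain ⟨g, rfl, -⟩ := exists_aff c 0
    have h := card_mul_coeff (x * unitLift p 1) g
    rw [map_mul, map_mul, affHom_unitLift, affHom_single] at h
    simp only [Prod.snd_mul, Prod.fst_mul, mul_zero, zero_mul, Matrix.trace_zero, zero_add,
      ← MonoidAlgebra.one_def, mul_one, MonoidAlgebra.coeff_mul_single_apply, map_inv, inv_inv,
      one_mul] at h
    rw [map_smul, Prod.smul_fst, MonoidAlgebra.coeff_smul_apply, ← h, smul_eq_mul,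
      inv_mul_cancel_left₀ hq]
    exact mem_padicGroupRing.mp hx2 g
  -- for the scalar part the formula reads `q v = (q - 1) b`, and `q - 1` is a unit
  · have h := card_mul_coeff_one (x - x * unitLift p 1)
    rw [map_sub, map_mul, affHom_unitLift] at h
    simp only [Prod.snd_mul, Prod.fst_mul, Prod.snd_sub, Prod.fst_sub, mul_zero, sub_zero,
      ← MonoidAlgebra.one_def, mul_one, sub_self, hb] at h
    obtain ⟨u, hu⟩ := hu
    obtain ⟨v, hv⟩ := mem_padicGroupRing.mp (sub_mem hx1 hx2) 1
    have hc : Fintype.card {a : F // a ≠ 0} = Nat.card Fˣ := by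
      rw [← Nat.card_eq_fintype_card, Nat.card_congr unitsEquivNeZero]
    have h' : (Fintype.card F : ℚ_[p]) * algebraMap ℤ_[p] ℚ_[p] v =
        algebraMap ℤ_[p] ℚ_[p] (Nat.card Fˣ : ℤ_[p]) * algebraMap ℤ_[p] ℚ_[p] b := by
      rw [hv, h, ← hc]
      simp [Matrix.trace]
    refine ⟨(u⁻¹ : (ℤ_[p])ˣ) * v, ?_⟩
    rw [map_smul, Prod.smul_snd, hb]
    have h2 : (Fintype.card F : ℚ_[p])⁻¹ * algebraMap ℤ_[p] ℚ_[p] b =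
        algebraMap ℤ_[p] ℚ_[p] ((u⁻¹ : (ℤ_[p])ˣ) * v) := by
      rw [inv_mul_eq_iff_eq_mul₀ hq, map_mul, mul_left_comm, h', ← hu, ← mul_assoc, ← map_mul,
        Units.inv_mul, map_one, one_mul]
    rw [← h2]
    ext i j
    by_cases hij : i = j <;> simp [hij]
  · rw [← algebraMap_smul ℚ_[p] (Fintype.card F : ℤ_[p]), map_natCast, smul_inv_smul₀ hq]

theorem card_smul_mem_centralConductor (hu : IsUnit (Nat.card Fˣ : ℤ_[p]))
    (hM : IsMaximalOrder ℚ_[p] M) (hle : padicGroupRing p (Aff F) ≤ M)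
    {z : MonoidAlgebra ℚ_[p] (Aff F)} (hz : z ∈ splitCentre p F) :
    (Fintype.card F : ℤ_[p]) • z ∈ centralConductor M (padicGroupRing p (Aff F)) := by
  rw [← centre_eq_splitCentre hu hM hle] at hz
  refine ⟨Subalgebra.smul_mem _ hz _, fun y hy => ?_⟩
  rw [smul_mul_assoc]
  exact card_smul_mem_of_mem_order hu hM.prop hle (mul_mem (mem_centre.mp hz).1 hy)

/-- The central conductor multiplies the split order into the group ring, because it is `q` times
the split centre; generalised adjoints of integral matrices lie in the split order. -/
theorem centralConductor_le_denominatorIdeal (hu : IsUnit (Nat.card Fˣ : ℤ_[p]))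
    (hM : IsMaximalOrder ℚ_[p] M) (hle : padicGroupRing p (Aff F) ≤ M) :
    centralConductor M (padicGroupRing p (Aff F)) ≤
      denominatorIdeal (padicGroupRing p (Aff F)) := by
  rintro x ⟨hxc, hx⟩
  have hcen := centre_eq_splitCentre hu hM hle
  rw [hcen] at hxc
  have hM' : ∀ y ∈ splitCentre p F, y ∈ M := fun y hy => by
    rw [← hcen] at hy
    exact (mem_centre.mp hy).1
  have hx1 : x ∈ padicGroupRing p (Aff F) := by simpa using hx 1 (one_mem M)
  obtain ⟨z, hz, rfl⟩ := exists_eq_card_smul hu hxc hx1 (hx _ (hM' _ (unitLift_mem 1)))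
  refine ⟨mem_centre.mpr ⟨hx1, fun y _ => mul_comm_of_mem_splitCentre hxc y⟩,
    fun n _ H hH i j => ?_⟩
  change ((Fintype.card F : ℤ_[p]) • z) * genAdjoint H i j ∈ _
  rw [smul_mul_assoc]
  exact card_smul_mem_of_mem_splitOrder (mul_mem (splitCentre_le hz)
    (genAdjoint_mem_splitOrder (fun i j => padicGroupRing_le_splitOrder (hH i j)) i j))

theorem two_smul_mem_centralConductor (hu : IsUnit (Nat.card Fˣ : ℤ_[p]))
    (hM : IsMaximalOrder ℚ_[p] M) (hle : padicGroupRing p (Aff F) ≤ M)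
    {x : MonoidAlgebra ℚ_[p] (Aff F)} (hx : x ∈ denominatorIdeal (padicGroupRing p (Aff F))) :
    (2 : ℤ_[p]) • x ∈ centralConductor M (padicGroupRing p (Aff F)) := by
  have hxc := centre_padicGroupRing_le hx.1
  have h2 := mul_mem_of_mem_denominatorIdeal hx (two_smul_unitLift_mem 1)
  rw [mul_smul_comm, ← smul_mul_assoc] at h2
  obtain ⟨z, hz, h⟩ := exists_eq_card_smul hu (Subalgebra.smul_mem _ hxc 2)
    (Subalgebra.smul_mem _ (mem_centre.mp hx.1).1 2) h2
  rw [h]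
  exact card_smul_mem_centralConductor hu hM hle hz

end affine

end DenominatorIdeal

end

open DenominatorIdeal in
theorem mainTheorem12 (p ℓ n : ℕ) [Fact p.Prime] (hℓ : ℓ.Prime)
    (F : Type*) [Field F] [Finite F] (hF : Nat.card F = ℓ ^ n)
    (M : Subalgebra ℤ_[p] (MonoidAlgebra ℚ_[p] (Aff F)))
    (hM : IsMaximalOrder ℚ_[p] M) (hle : padicGroupRing p (Aff F) ≤ M) :
    (p ≠ ℓ →
      denominatorIdeal (padicGroupRing p (Aff F)) =
          Subalgebra.toSubmodule (centre (padicGroupRing p (Aff F))) ∧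
        normIdeal (padicGroupRing p (Aff F)) =
          Subalgebra.toSubmodule (centre (padicGroupRing p (Aff F)))) ∧
    (p = ℓ → p ≠ 2 →
      denominatorIdeal (padicGroupRing p (Aff F)) =
          centralConductor M (padicGroupRing p (Aff F)) ∧
        normIdeal (padicGroupRing p (Aff F)) = Subalgebra.toSubmodule (centre M)) ∧
    (p = ℓ → p = 2 →
      (2 : ℤ_[p]) • denominatorIdeal (padicGroupRing p (Aff F)) ≤
          centralConductor M (padicGroupRing p (Aff F)) ∧
        centralConductor M (padicGroupRing p (Aff F)) ≤
          denominatorIdeal (padicGroupRing p (Aff F)) ∧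
        (2 : ℤ_[p]) • Subalgebra.toSubmodule (centre M) ≤
          normIdeal (padicGroupRing p (Aff F)) ∧
        normIdeal (padicGroupRing p (Aff F)) ≤ Subalgebra.toSubmodule (centre M)) := by
  classical
  have := Fintype.ofFinite F
  have hp : p.Prime := Fact.out
  have hunit : p = ℓ → IsUnit (Nat.card Fˣ : ℤ_[p]) := by
    rintro rfl
    rw [PadicInt.isUnit_iff, PadicInt.norm_natCast_eq_one_iff, hp.coprime_iff_not_dvd]
    intro h
    -- `n = 0` is impossible, as a field has more than one element
    have hn : n ≠ 0 := by
      rintro rfl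
      exact absurd hF (by simpa using (Finite.one_lt_card (α := F)).ne')
    have hd : p ∣ Nat.card Fˣ + 1 := by
      rw [← Nat.card_eq_card_units_add_one, hF]
      exact dvd_pow_self p hn
    exact hp.one_lt.ne' (Nat.dvd_one.mp ((Nat.dvd_add_right h).mp hd))
  refine ⟨fun hne => denominatorIdeal_eq_and_normIdeal_eq_of_isUnit ?_,
    fun heq hp2 => ?_, fun heq _ => ?_⟩
  · rw [PadicInt.isUnit_iff, PadicInt.norm_natCast_eq_one_iff, ← Nat.card_eq_fintype_card, hF]
    exact ((Nat.coprime_primes hp hℓ).mpr hne).pow_right n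
  · have hu := hunit heq
    obtain ⟨v, hv⟩ : IsUnit (2 : ℤ_[p]) := by
      rw [← Nat.cast_ofNat, PadicInt.isUnit_iff, PadicInt.norm_natCast_eq_one_iff]
      exact (Nat.coprime_primes hp Nat.prime_two).mpr hp2
    have hhalf : ∀ x : MonoidAlgebra ℚ_[p] (Aff F), x = (v⁻¹ : (ℤ_[p])ˣ).1 • (2 : ℤ_[p]) • x := by
      intro x
      rw [← hv, smul_smul, Units.inv_mul, one_smul]
    rw [centre_eq_splitCentre hu hM hle]
    refine ⟨le_antisymm (fun x hx => ?_) (centralConductor_le_denominatorIdeal hu hM hle),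
      le_antisymm normIdeal_le_splitCentre fun x hx => ?_⟩
    · rw [hhalf x]
      exact Submodule.smul_mem _ _ (two_smul_mem_centralConductor hu hM hle hx)
    · rw [hhalf x]
      exact Submodule.smul_mem _ _ (two_smul_mem_normIdeal hx)
  · have hu := hunit heq
    rw [centre_eq_splitCentre hu hM hle]
    refine ⟨?_, centralConductor_le_denominatorIdeal hu hM hle, ?_, normIdeal_le_splitCentre⟩
    · rintro _ ⟨x, hx, rfl⟩
      exact two_smul_mem_centralConductor hu hM hle hx
    · rintro _ ⟨x, hx, rfl⟩
      exact two_smul_mem_normIdeal hx
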